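/- **Setting.** Let $V, W$ be real Banach spaces, $T>0$ and $\beta\in(\tfrac13,\tfrac12]$. Let $V\otimes V$ be the (completed) projective tensor square, so that $\mathcal L(V,\mathcal L(V,W))\simeq\mathcal L(V\otimes V,W)$. Let $\operatorname{Sym}(V\otimes V)$ be its subspace of tensors invariant under $v\otimes w\mapsto w\otimes v$, and let $\operatorname{Sym}(v\otimes w)=\tfrac12(v\otimes w+w\otimes v)$. Write $X_{s,t}=X_t-X_s$. A *$\beta$-Hölder reduced rough path* on $[0,T]$ is a pair $\mathbf X=(X,\mathbb S)$ with $X:[0,T]\to V$ and $\mathbb S:[0,T]^2\to\operatorname{Sym}(V\otimes V)$, such that $\mathbb S_{s,t}-\mathbb S_{s,u}-\mathbb S_{u,t}=\operatorname{Sym}(X_{s,u}\otimes X_{u,t})$ for all $s,u,t\in[0,T]$, and $$\sup_{0\le s<t\le T}\frac{|X_{s,t}|}{|t-s|^{\beta}}<\infty,\qquad \sup_{0\le s<t\le T}\frac{|\mathbb S_{s,t}|}{|t-s|^{2\beta}}<\infty .$$ A *reduced $\mathbf X$-controlled rough path* on $[0,\tau]$, where $0<\tau\le T$, is a pair $(Y,Y'):[0,\tau]\to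 W\times\mathcal L(V,W)$ such that $Y$ and $Y'$ are $\beta$-Hölder and $R_{s,t}=Y_{s,t}-Y'_sX_{s,t}$ satisfies $\sup_{0\le s<t\le\tau}|R_{s,t}|/|t-s|^{2\beta}<\infty$. For $(Z,Z'):[0,\tau]\to\mathcal L(V,W)\times\mathcal L(V,\mathcal L(V,W))$, the *reduced rough integral* is $$\int_0^t Z_r\,d\mathbf X_r:=\lim_{|\pi|\to0}\sum_{[t_i,t_{i+1}]\in\pi}\bigl(Z_{t_i}X_{t_i,t_{i+1}}+Z'_{t_i}\mathbb S_{t_i,t_{i+1}}\bigr),$$ the limit being over partitions $\pi$ of $[0,t]$ whose mesh tends to $0$. **Theorem.** Let $\xi\in W$, let $\mathbf X=(X,\mathbb S)$ be a $\beta$-Hölder reduced rough path on $[0,T]$, and let $F\in C^3(W;\mathcal L(V,W))$ be such that for every $y\in W$ the bilinear map $(v,w)\mapsto\bigl(DF(y)(F(y)v)\bigr)w$ is symmetric on $V\times V$. For $0<\tau\le T$, call $(Y,Y')$ a *solution on $[0,\tau]$* if it is a reduced $\mathbf X$-controlled rough path on $[0,\tau]$ with $Y'=F(Y)$ and, for every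 $t\in[0,\tau]$, the reduced rough integral of $(F(Y),DF(Y)Y')$ exists and $$Y_t=\xi+\int_0^tF(Y_r)\,d\mathbf X_r .$$ 1. There is $\tau_0\in(0,T]$ such that for every $\tau\in(0,\tau_0]$ there is exactly one solution on $[0,\tau]$. 2. If moreover $F\in C^3_b$, that is, $F,DF,D^2F,D^3F$ are bounded, then there is a solution on all of $[0,T]$, and every solution on any $[0,\tau]$ with $0<\tau\le T$ is its restriction to $[0,\tau]$. In particular it is the only solution on $[0,T]$. -/

import Mathlib

open scoped TensorProduct

namespace ReducedRough

noncomputable section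

/-! ### The Banach space `V ⊗ V` and symmetric tensors -/

/-- The Banach tensor square `V ⊗ V`: the completion of the algebraic tensor square for the
projective norm (which is the norm Mathlib puts on `⨂[ℝ] _ : Fin 2, V`).  For this norm
`L(V, L(V, W)) ≃ L(V ⊗ V, W)`.  For finite-dimensional `V` it is the algebraic tensor square. -/
abbrev Tensor2 (V : Type*) [NormedAddCommGroup V] [NormedSpace ℝ V] : Type _ :=
  UniformSpace.Completion (⨂[ℝ] _ : Fin 2, V)

/-- The elementary tensor `v ⊗ w`. -/
def tmul {V : Type*} [NormedAddCommGroup V] [NormedSpace ℝ V] (v w : V) : Tensor2 V :=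
  ((PiTensorProduct.tprod ℝ ![v, w] : ⨂[ℝ] _ : Fin 2, V) : Tensor2 V)

/-- A bounded bilinear map `B : V → V → W`, seen as a continuous multilinear map in two
variables. -/
def bilinToMultilin {V W : Type*} [NormedAddCommGroup V] [NormedSpace ℝ V]
    [NormedAddCommGroup W] [NormedSpace ℝ W] (B : V →L[ℝ] V →L[ℝ] W) :
    ContinuousMultilinearMap ℝ (fun _ : Fin 2 => V) W :=
  ContinuousLinearMap.uncurryLeft
    (((continuousMultilinearCurryFin1 ℝ V W).symm.toContinuousLinearEquiv.toContinuousLinearMap).comp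
      B)

/-- The map `L(V, L(V, W)) → L(V ⊗ V, W)`, with `tensorLift B (v ⊗ w) = B v w`
(see `tensorLift_tmul`). -/
def tensorLift {V W : Type*} [NormedAddCommGroup V] [NormedSpace ℝ V]
    [NormedAddCommGroup W] [NormedSpace ℝ W] [CompleteSpace W] (B : V →L[ℝ] V →L[ℝ] W) :
    Tensor2 V →L[ℝ] W :=
  (PiTensorProduct.liftIsometry ℝ (fun _ : Fin 2 => V) W (bilinToMultilin B)).extend
    UniformSpace.Completion.toComplL

/-- The action of the transposition in `S₂` on `V ⊗ V`: the continuous linear map with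
`v ⊗ w ↦ w ⊗ v` (see `swap_tmul`). -/
def swap {V : Type*} [NormedAddCommGroup V] [NormedSpace ℝ V] : Tensor2 V →L[ℝ] Tensor2 V :=
  (UniformSpace.Completion.toComplL.comp
    (PiTensorProduct.liftIsometry ℝ (fun _ : Fin 2 => V) (⨂[ℝ] _ : Fin 2, V)
      ((PiTensorProduct.tprodL ℝ).domDomCongr (Equiv.swap (0 : Fin 2) 1)))).extend
    UniformSpace.Completion.toComplL

/-- The symmetrization operator `Sym T = (T + σ · T) / 2` on `V ⊗ V`. -/
def sym {V : Type*} [NormedAddCommGroup V] [NormedSpace ℝ V] (T : Tensor2 V) : Tensor2 V :=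
  (1 / 2 : ℝ) • (T + swap T)

/-- `T ∈ Sym(V ⊗ V)`: the tensor `T` is invariant under `S₂`. -/
def IsSymTensor {V : Type*} [NormedAddCommGroup V] [NormedSpace ℝ V] (T : Tensor2 V) : Prop :=
  swap T = T

theorem tensorLift_tmul {V W : Type*} [NormedAddCommGroup V] [NormedSpace ℝ V]
    [NormedAddCommGroup W] [NormedSpace ℝ W] [CompleteSpace W] (B : V →L[ℝ] V →L[ℝ] W)
    (v w : V) : tensorLift B (tmul v w) = B v w := by
  have h := ContinuousLinearMap.extend_eq
    (PiTensorProduct.liftIsometry ℝ (fun _ : Fin 2 => V) W (bilinToMultilin B))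
    (e := UniformSpace.Completion.toComplL)
    UniformSpace.Completion.denseRange_coe
    (UniformSpace.Completion.isUniformInducing_coe _) (PiTensorProduct.tprod ℝ ![v, w])
  refine h.trans ?_
  simp [bilinToMultilin]

theorem swap_tmul {V : Type*} [NormedAddCommGroup V] [NormedSpace ℝ V] (v w : V) :
    swap (tmul v w) = tmul w v := by
  have h := ContinuousLinearMap.extend_eq
    (UniformSpace.Completion.toComplL.comp
    (PiTensorProduct.liftIsometry ℝ (fun _ : Fin 2 => V) (⨂[ℝ] _ : Fin 2, V)
      ((PiTensorProduct.tprodL ℝ).domDomCongr (Equiv.swap (0 : Fin 2) 1))))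
    (e := UniformSpace.Completion.toComplL)
    UniformSpace.Completion.denseRange_coe
    (UniformSpace.Completion.isUniformInducing_coe _) (PiTensorProduct.tprod ℝ ![v, w])
  refine h.trans ?_
  have e : (fun i => (![v, w] : Fin 2 → V) (Equiv.swap (0 : Fin 2) 1 i)) = ![w, v] := by
    funext i
    fin_cases i <;> simp
  simp [tmul, e]

/-! ### Reduced rough paths, controlled rough paths and the reduced rough integral

Paths are total functions of a real variable; only their values on the time interval matter. -/

/-- `sup_{0 ≤ s < t ≤ T} ‖A s t‖ / |t - s| ^ γ < ∞`. -/
def HolderBound {E : Type*} [NormedAddCommGroup E] (γ T : ℝ) (A : ℝ → ℝ → E) : Prop :=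
  ∃ C : ℝ, ∀ s t : ℝ, 0 ≤ s → s < t → t ≤ T → ‖A s t‖ ≤ C * (t - s) ^ γ

/-- `(X, S)` is a `β`-Hölder reduced rough path in `V` over `[0, T]`. -/
structure IsReducedRoughPath {V : Type*} [NormedAddCommGroup V] [NormedSpace ℝ V]
    (β T : ℝ) (X : ℝ → V) (S : ℝ → ℝ → Tensor2 V) : Prop where
  symmetric : ∀ s ∈ Set.Icc 0 T, ∀ t ∈ Set.Icc 0 T, IsSymTensor (S s t)
  chen : ∀ s ∈ Set.Icc 0 T, ∀ u ∈ Set.Icc 0 T, ∀ t ∈ Set.Icc 0 T,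
    S s t - S s u - S u t = sym (tmul (X u - X s) (X t - X u))
  holder_fst : HolderBound β T (fun s t => X t - X s)
  holder_snd : HolderBound (2 * β) T S

/-- `(Y, Y')` is a (reduced) controlled rough path over `[0, T]`: `Y` and `Y'` are `β`-Hölder and
the remainder `Y_{s,t} - Y'_s X_{s,t}` is `2β`-Hölder. -/
structure IsControlled {V W : Type*} [NormedAddCommGroup V] [NormedSpace ℝ V]
    [NormedAddCommGroup W] [NormedSpace ℝ W]
    (β T : ℝ) (X : ℝ → V) (Y : ℝ → W) (Y' : ℝ → V →L[ℝ] W) : Prop where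
  holder : HolderBound β T (fun s t => Y t - Y s)
  holder_deriv : HolderBound β T (fun s t => Y' t - Y' s)
  holder_remainder : HolderBound (2 * β) T (fun s t => Y t - Y s - Y' s (X t - X s))

/-- `0 = p 0 < p 1 < ⋯ < p n = t` is a partition of `[0, t]`. -/
def IsPartition (t : ℝ) (n : ℕ) (p : ℕ → ℝ) : Prop :=
  p 0 = 0 ∧ p n = t ∧ ∀ i < n, p i < p (i + 1)

/-- The reduced rough integral `∫_0^t Z_r d(X, S)_r` of the path `(Z, Z')` exists and equals `I`:
the compensated Riemann sums `∑ Z_{t_i} X_{t_i,t_{i+1}} + Z'_{t_i} S_{t_i,t_{i+1}}` converge to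
`I` as the mesh of the partition of `[0, t]` tends to zero. -/
def HasReducedIntegral {V W : Type*} [NormedAddCommGroup V] [NormedSpace ℝ V]
    [NormedAddCommGroup W] [NormedSpace ℝ W] [CompleteSpace W]
    (X : ℝ → V) (S : ℝ → ℝ → Tensor2 V) (Z : ℝ → V →L[ℝ] W) (Z' : ℝ → V →L[ℝ] V →L[ℝ] W)
    (t : ℝ) (I : W) : Prop :=
  ∀ ε > 0, ∃ δ > 0, ∀ (n : ℕ) (p : ℕ → ℝ), IsPartition t n p →
    (∀ i < n, p (i + 1) - p i < δ) →
    ‖∑ i ∈ Finset.range n,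
        (Z (p i) (X (p (i + 1)) - X (p i)) + tensorLift (Z' (p i)) (S (p i) (p (i + 1)))) - I‖ < ε

/-! ### Rough differential equations -/

/-- `(Y, Y')` is a controlled rough path over `[0, τ]` with `Y' = F(Y)` which solves
`Y_t = ξ + ∫_0^t F(Y_r) d(X, S)_r` for all `t ∈ [0, τ]`, where `F(Y)` stands for the controlled
path `(F(Y), DF(Y) Y')`. -/
structure IsSolution {V W : Type*} [NormedAddCommGroup V] [NormedSpace ℝ V]
    [NormedAddCommGroup W] [NormedSpace ℝ W] [CompleteSpace W]
    (β τ : ℝ) (X : ℝ → V) (S : ℝ → ℝ → Tensor2 V) (F : W → V →L[ℝ] W) (ξ : W)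
    (Y : ℝ → W) (Y' : ℝ → V →L[ℝ] W) : Prop where
  controlled : IsControlled β τ X Y Y'
  deriv_eq : ∀ t ∈ Set.Icc 0 τ, Y' t = F (Y t)
  equation : ∀ t ∈ Set.Icc 0 τ, ∃ I : W,
    HasReducedIntegral X S (fun r => F (Y r)) (fun r => (fderiv ℝ F (Y r)).comp (Y' r)) t I ∧
      Y t = ξ + I

/-- The derivative part of `F(Y)` along any path with `Y' = F(Y)`, that is, the bilinear map
`(v, w) ↦ (DF(y) (F(y) v)) w`, is symmetric on `V ⊗ V`, at every point `y`. -/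
def HasSymmetricDerivative {V W : Type*} [NormedAddCommGroup V] [NormedSpace ℝ V]
    [NormedAddCommGroup W] [NormedSpace ℝ W] (F : W → V →L[ℝ] W) : Prop :=
  ∀ (y : W) (v w : V), fderiv ℝ F y (F y v) w = fderiv ℝ F y (F y w) v

/-- `F ∈ C^m_b`: `F` is `C^m`, and `F, DF, …, D^m F` are bounded. -/
def IsCb {E G : Type*} [NormedAddCommGroup E] [NormedSpace ℝ E]
    [NormedAddCommGroup G] [NormedSpace ℝ G] (m : ℕ) (F : E → G) : Prop :=
  ContDiff ℝ m F ∧ ∃ C : ℝ, ∀ k ≤ m, ∀ x : E, ‖iteratedFDeriv ℝ k F x‖ ≤ C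

end

end ReducedRough

/-! The integral equation is traded for Davie's expansion: where `F` has `C^3` bounds along the
path, `Y` solves the equation exactly when its `residual`
$Y_{s,t}-F(Y_s)X_{s,t}-DF(Y_s)F(Y_s)\mathbb S_{s,t}$ is $O(|t-s|^{3\beta})$ (`IsDavieOn.isSolution`,
`IsSolution.exists_isDavieOn`). Since $DF\cdot F$ is symmetric, it sees only the symmetric part of
$X_{s,u}\otimes X_{u,t}$, so the reduced Chen relation suffices: the additivity defect of Euler
steps is a third order Taylor remainder (`eulerStep_add_sub`, `stepDefect_le`). As $3\beta>1$, such
defects can be summed by `discrete_sewing`.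

Existence comes from second order Euler schemes on finite grids, not from a fixed point. Their
residuals are bounded uniformly in the grid (`eulerScheme_bound`). `stability` compares two paths
through the difference of their residuals, measured with an exponent $\gamma$ satisfying
$\max(1,2\beta)<\gamma<3\beta$: $\gamma>1$ permits sewing, $\gamma>2\beta$ leaves a positive power
of the interval length that absorbs the Lipschitz constants, and $\gamma<3\beta$ leaves a positive
power of the mesh. Hence the schemes are Cauchy under refinement (`exists_davie_of_small`), and two
Davie paths with the same start agree on a short interval (`davie_unique`).

Uniqueness spreads from short intervals by a connectedness argument (`IsSolution.eqOn`). With global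
bounds the existence time does not depend on the starting point, so finitely many local solutions
glue to one on $[0,T]$ (`exists_davie_global`). -/

namespace ReducedRough

noncomputable section

/-! ### The lift of bounded bilinear maps -/

section Tensor

variable {V W : Type*} [NormedAddCommGroup V] [NormedSpace ℝ V]
  [NormedAddCommGroup W] [NormedSpace ℝ W]

theorem tensorLift_coe [CompleteSpace W] (B : V →L[ℝ] V →L[ℝ] W) (x : ⨂[ℝ] _ : Fin 2, V) :
    tensorLift B (x : Tensor2 V) =
      PiTensorProduct.liftIsometry ℝ (fun _ : Fin 2 => V) W (bilinToMultilin B) x :=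
  ContinuousLinearMap.extend_eq
    (PiTensorProduct.liftIsometry ℝ (fun _ : Fin 2 => V) W (bilinToMultilin B))
    (e := UniformSpace.Completion.toComplL)
    UniformSpace.Completion.denseRange_coe
    (UniformSpace.Completion.isUniformInducing_coe _) x

theorem bilinToMultilin_sub (B B' : V →L[ℝ] V →L[ℝ] W) :
    bilinToMultilin (B - B') = bilinToMultilin B - bilinToMultilin B' := by
  ext m
  simp [bilinToMultilin]

theorem tensorLift_sub [CompleteSpace W] (B B' : V →L[ℝ] V →L[ℝ] W) (x : Tensor2 V) :
    tensorLift (B - B') x = tensorLift B x - tensorLift B' x := by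
  induction x using UniformSpace.Completion.induction_on with
  | hp => exact isClosed_eq (by fun_prop) (by fun_prop)
  | ih a => simp [tensorLift_coe, bilinToMultilin_sub]

theorem norm_bilinToMultilin_le (B : V →L[ℝ] V →L[ℝ] W) : ‖bilinToMultilin B‖ ≤ ‖B‖ := by
  refine ContinuousMultilinearMap.opNorm_le_bound (norm_nonneg B) fun m => ?_
  have h : bilinToMultilin B m = B (m 0) (m 1) := by
    simp [bilinToMultilin, Fin.tail]
  rw [h, Fin.prod_univ_two, ← mul_assoc]
  exact B.le_opNorm₂ _ _

theorem norm_tensorLift_le [CompleteSpace W] (B : V →L[ℝ] V →L[ℝ] W) (x : Tensor2 V) :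
    ‖tensorLift B x‖ ≤ ‖B‖ * ‖x‖ := by
  induction x using UniformSpace.Completion.induction_on with
  | hp => exact isClosed_le (by fun_prop) (by fun_prop)
  | ih a =>
    rw [tensorLift_coe, UniformSpace.Completion.norm_coe]
    refine (ContinuousLinearMap.le_opNorm _ _).trans
      (mul_le_mul_of_nonneg_right ?_ (norm_nonneg _))
    rw [LinearIsometryEquiv.norm_map]
    exact norm_bilinToMultilin_le B

/-- This is where the symmetry hypothesis on `F` acts: a symmetric form cannot tell a tensor from
its symmetrization, so no antisymmetric second level is needed. -/
theorem tensorLift_sym_tmul [CompleteSpace W] (B : V →L[ℝ] V →L[ℝ] W) (hB : ∀ v w, B v w = B w v) (v w : V) :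
    tensorLift B (sym (tmul v w)) = B v w := by
  rw [sym, map_smul, map_add, swap_tmul, tensorLift_tmul, tensorLift_tmul, hB w v, ← two_smul ℝ,
    smul_smul]
  norm_num

end Tensor

/-! ### Estimates for maps with Lipschitz derivative -/

section Calculus

variable {E G : Type*} [NormedAddCommGroup E] [NormedSpace ℝ E]
  [NormedAddCommGroup G] [NormedSpace ℝ G]

/-- `g` is differentiable and, on `U`, its derivative is bounded by `K` and `K`-Lipschitz. -/
structure IsC11On (g : E → G) (U : Set E) (K : ℝ) : Prop where
  diff : Differentiable ℝ g
  bound : ∀ x ∈ U, ‖fderiv ℝ g x‖ ≤ K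
  lip : ∀ x ∈ U, ∀ y ∈ U, ‖fderiv ℝ g y - fderiv ℝ g x‖ ≤ K * ‖y - x‖

variable {g : E → G} {U : Set E} {K : ℝ}

theorem isC11On_of_contDiff (hU : Convex ℝ U) (hg : ContDiff ℝ 2 g)
    (hb : ∀ k, 1 ≤ k → k ≤ 2 → ∀ x ∈ U, ‖iteratedFDeriv ℝ k g x‖ ≤ K) : IsC11On g U K := by
  have hg1 : ContDiff ℝ 1 (fderiv ℝ g) := hg.fderiv_right (by norm_num)
  refine ⟨hg.differentiable (by norm_num), fun x hx => ?_, fun x hx y hy => ?_⟩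
  · have := hb 1 le_rfl (by norm_num) x hx
    rwa [← norm_iteratedFDeriv_fderiv, norm_iteratedFDeriv_zero] at this
  · refine hU.norm_image_sub_le_of_norm_fderiv_le (𝕜 := ℝ)
      (fun x _ => hg1.differentiable (by norm_num) x) (fun x hx => ?_) hx hy
    have := hb 2 (by norm_num) le_rfl x hx
    rwa [← norm_iteratedFDeriv_fderiv, ← norm_iteratedFDeriv_fderiv,
      norm_iteratedFDeriv_zero] at this

theorem segment_point_mem (hU : Convex ℝ U) {x y : E} (hx : x ∈ U) (hy : y ∈ U) {θ : ℝ}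
    (hθ : θ ∈ Set.Icc (0 : ℝ) 1) : x + θ • (y - x) ∈ U :=
  hU.add_smul_sub_mem hx hy hθ

theorem norm_segment_sub_le {x y x' y' : E} {θ : ℝ} (hθ : θ ∈ Set.Icc (0 : ℝ) 1) :
    ‖(x + θ • (y - x)) - (x' + θ • (y' - x'))‖ ≤ ‖x - x'‖ + ‖y - y'‖ := by
  have e : (x + θ • (y - x)) - (x' + θ • (y' - x')) = (1 - θ) • (x - x') + θ • (y - y') := by
    module
  rw [e]
  refine (norm_add_le _ _).trans (add_le_add ?_ ?_)
  · rw [norm_smul, Real.norm_of_nonneg (by linarith [hθ.2])]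
    nlinarith [norm_nonneg (x - x'), hθ.1]
  · rw [norm_smul, Real.norm_of_nonneg hθ.1]
    nlinarith [norm_nonneg (y - y'), hθ.2]

theorem hasDerivAt_comp_segment (hg : Differentiable ℝ g) (x v : E) (θ : ℝ) :
    HasDerivAt (fun θ : ℝ => g (x + θ • v)) (fderiv ℝ g (x + θ • v) v) θ := by
  have h1 : HasDerivAt (fun θ : ℝ => x + θ • v) v θ := by
    simpa using ((hasDerivAt_id θ).smul_const v).const_add x
  exact (hg _).hasFDerivAt.comp_hasDerivAt θ h1

theorem norm_apply_sub_apply_le {A A' : E →L[ℝ] G} {v v' : E} {a b : ℝ} (ha : ‖A‖ ≤ a)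
    (hb : ‖A - A'‖ ≤ b) : ‖A v - A' v'‖ ≤ a * ‖v - v'‖ + b * ‖v'‖ := by
  have e : A v - A' v' = A (v - v') + (A - A') v' := by simp
  rw [e]
  exact (norm_add_le _ _).trans (add_le_add (A.le_of_opNorm_le ha _)
    ((A - A').le_of_opNorm_le hb _))

theorem IsC11On.lipschitz (h : IsC11On g U K) (hU : Convex ℝ U) {x y : E} (hx : x ∈ U)
    (hy : y ∈ U) : ‖g y - g x‖ ≤ K * ‖y - x‖ :=
  hU.norm_image_sub_le_of_norm_fderiv_le (𝕜 := ℝ) (fun x _ => h.diff x) h.bound hx hy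

/-- The four point estimate for increments. -/
theorem IsC11On.norm_sub_sub_sub_le (h : IsC11On g U K) (hK : 0 ≤ K) (hU : Convex ℝ U)
    {x y x' y' : E} (hx : x ∈ U) (hy : y ∈ U) (hx' : x' ∈ U) (hy' : y' ∈ U) :
    ‖(g y - g x) - (g y' - g x')‖ ≤
      K * ‖(y - x) - (y' - x')‖ + K * (‖x - x'‖ + ‖y - y'‖) * ‖y' - x'‖ := by
  have key := norm_image_sub_le_of_norm_deriv_le_segment_01'
    (f := fun θ : ℝ => g (x + θ • (y - x)) - g (x' + θ • (y' - x')))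
    (C := K * ‖(y - x) - (y' - x')‖ + K * (‖x - x'‖ + ‖y - y'‖) * ‖y' - x'‖)
    (fun θ _ => ((hasDerivAt_comp_segment h.diff x (y - x) θ).sub
      (hasDerivAt_comp_segment h.diff x' (y' - x') θ)).hasDerivWithinAt) ?_
  · have e : (g y - g x) - (g y' - g x') = (g y - g y') - (g x - g x') := by abel
    simpa [e] using key
  · intro θ hθ
    have hθ' := Set.Ico_subset_Icc_self hθ
    refine norm_apply_sub_apply_le (h.bound _ (segment_point_mem hU hx hy hθ'))
      ((h.lip _ (segment_point_mem hU hx' hy' hθ') _ (segment_point_mem hU hx hy hθ')).trans ?_)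
    exact mul_le_mul_of_nonneg_left (norm_segment_sub_le hθ') hK

/-- The four point estimate for first order Taylor remainders. -/
theorem norm_taylor_sub_taylor_le (h : IsC11On g U K) (h' : IsC11On (fderiv ℝ g) U K) (hK : 0 ≤ K)
    (hU : Convex ℝ U) {x y x' y' : E} (hx : x ∈ U) (hy : y ∈ U) (hx' : x' ∈ U) (hy' : y' ∈ U) :
    ‖(g y - g x - fderiv ℝ g x (y - x)) - (g y' - g x' - fderiv ℝ g x' (y' - x'))‖ ≤
      K * ‖y - x‖ * ‖(y - x) - (y' - x')‖ +
      K * (‖(y - x) - (y' - x')‖ + 2 * (‖x - x'‖ + ‖y - y'‖) * ‖y' - x'‖) * ‖y' - x'‖ := by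
  -- Subtracting the linear term along the segment leaves a derivative of the form $(Dg(x+\theta
  -- v)-Dg(x))v$. Comparing two of these is the four point estimate for $Dg$, which is why `h'` is
  -- needed.
  have hder : ∀ (x v : E) (θ : ℝ), HasDerivAt
      (fun θ : ℝ => g (x + θ • v) - θ • fderiv ℝ g x v)
      ((fderiv ℝ g (x + θ • v) - fderiv ℝ g x) v) θ := by
    intro x v θ
    have := (hasDerivAt_comp_segment h.diff x v θ).sub
      ((hasDerivAt_id θ).smul_const (fderiv ℝ g x v))
    rwa [one_smul, ← sub_apply] at this
  have key := norm_image_sub_le_of_norm_deriv_le_segment_01'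
    (f := fun θ : ℝ => (g (x + θ • (y - x)) - θ • fderiv ℝ g x (y - x)) -
      (g (x' + θ • (y' - x')) - θ • fderiv ℝ g x' (y' - x')))
    (C := K * ‖y - x‖ * ‖(y - x) - (y' - x')‖ +
      K * (‖(y - x) - (y' - x')‖ + 2 * (‖x - x'‖ + ‖y - y'‖) * ‖y' - x'‖) * ‖y' - x'‖)
    (fun θ _ => ((hder x (y - x) θ).sub (hder x' (y' - x') θ)).hasDerivWithinAt) ?_
  · have e : (g y - g x - fderiv ℝ g x (y - x)) - (g y' - g x' - fderiv ℝ g x' (y' - x')) =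
      ((g y - fderiv ℝ g x (y - x)) - (g y' - fderiv ℝ g x' (y' - x'))) - (g x - g x') := by abel
    rw [e]
    simpa only [one_smul, zero_smul, add_zero, sub_zero, add_sub_cancel] using key
  · intro θ hθ
    have hθ' := Set.Ico_subset_Icc_self hθ
    have hz := segment_point_mem hU hx hy hθ'
    have hz' := segment_point_mem hU hx' hy' hθ'
    have hseg := norm_segment_sub_le (x := x) (y := y) (x' := x') (y' := y') hθ'
    refine norm_apply_sub_apply_le ?_ ?_
    · refine (h.lip _ hx _ hz).trans (mul_le_mul_of_nonneg_left ?_ hK)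
      rw [add_sub_cancel_left, norm_smul, Real.norm_of_nonneg hθ'.1]
      exact mul_le_of_le_one_left (norm_nonneg _) hθ'.2
    · refine (h'.norm_sub_sub_sub_le hK hU hx hz hx' hz').trans ?_
      rw [add_sub_cancel_left, add_sub_cancel_left, ← smul_sub, norm_smul, norm_smul,
        Real.norm_of_nonneg hθ'.1, mul_assoc K, ← mul_add]
      refine mul_le_mul_of_nonneg_left (add_le_add ?_ ?_) hK
      · exact mul_le_of_le_one_left (norm_nonneg _) hθ'.2
      · refine mul_le_mul ?_ (mul_le_of_le_one_left (norm_nonneg _) hθ'.2)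
          (mul_nonneg hθ'.1 (norm_nonneg _)) (by positivity)
        linarith [norm_nonneg (y - y')]

end Calculus

/-! ### Bounds on the vector field -/

section Field

variable {V W : Type*} [NormedAddCommGroup V] [NormedSpace ℝ V]
  [NormedAddCommGroup W] [NormedSpace ℝ W]

/-- The derivative part `DF · F` of the controlled path `F(Y)`. -/
def fieldDeriv (F : W → V →L[ℝ] W) (y : W) : V →L[ℝ] V →L[ℝ] W := (fderiv ℝ F y).comp (F y)

/-- On `U`, the vector field `F` satisfies the `C^3` estimates with constant `K`. -/
structure FieldBound (F : W → V →L[ℝ] W) (U : Set W) (K : ℝ) : Prop where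
  one_le : 1 ≤ K
  convex : Convex ℝ U
  cont : Continuous F
  cont_deriv : Continuous (fieldDeriv F)
  norm_le : ∀ x ∈ U, ‖F x‖ ≤ K
  norm_deriv_le : ∀ x ∈ U, ‖fieldDeriv F x‖ ≤ K
  c11 : IsC11On F U K
  c11_fderiv : IsC11On (fderiv ℝ F) U K
  c11_deriv : IsC11On (fieldDeriv F) U K

theorem contDiff_fieldDeriv {F : W → V →L[ℝ] W} (hF : ContDiff ℝ 3 F) :
    ContDiff ℝ 2 (fieldDeriv F) :=
  (hF.fderiv_right (m := 2) (by norm_num)).clm_comp (hF.of_le (by norm_num))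

/-- Leibniz rule: the binomial coefficients sum to $2^k\le 4$. -/
theorem norm_iteratedFDeriv_comp_le {D A B E : Type*} [NormedAddCommGroup D] [NormedSpace ℝ D]
    [NormedAddCommGroup A] [NormedSpace ℝ A] [NormedAddCommGroup B] [NormedSpace ℝ B]
    [NormedAddCommGroup E] [NormedSpace ℝ E] {f : D → B →L[ℝ] E} {g : D → A →L[ℝ] B}
    (hf : ContDiff ℝ 2 f) (hg : ContDiff ℝ 2 g) {x : D} {C : ℝ}
    (hfC : ∀ k ≤ 2, ‖iteratedFDeriv ℝ k f x‖ ≤ C) (hgC : ∀ k ≤ 2, ‖iteratedFDeriv ℝ k g x‖ ≤ C)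
    {k : ℕ} (hk : k ≤ 2) :
    ‖iteratedFDeriv ℝ k (fun y => (f y).comp (g y)) x‖ ≤ 4 * C ^ 2 := by
  have hC0 : 0 ≤ C := (norm_nonneg _).trans (hfC 0 (by norm_num))
  have h := ContinuousLinearMap.norm_iteratedFDeriv_le_of_bilinear_of_le_one
    (ContinuousLinearMap.compL ℝ A B E) hf hg x (n := k)
    (by exact_mod_cast hk) (ContinuousLinearMap.norm_compL_le _ _ _ _)
  refine h.trans ((Finset.sum_le_sum (g := fun i => (k.choose i : ℝ) * C ^ 2)
    fun i hi => ?_).trans ?_)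
  · rw [mul_assoc, sq]
    have hi' := Finset.mem_range.1 hi
    exact mul_le_mul_of_nonneg_left (mul_le_mul (hfC _ (by omega)) (hgC _ (by omega))
      (norm_nonneg _) hC0) (Nat.cast_nonneg _)
  · rw [← Finset.sum_mul, ← Nat.cast_sum, Nat.sum_range_choose]
    have : ((2 ^ k : ℕ) : ℝ) ≤ 4 := by
      exact_mod_cast (Nat.pow_le_pow_right (by norm_num) hk : 2 ^ k ≤ 2 ^ 2)
    exact mul_le_mul_of_nonneg_right this (sq_nonneg _)

theorem norm_iteratedFDeriv_fieldDeriv_le {F : W → V →L[ℝ] W} (hF : ContDiff ℝ 3 F) {x : W} {C : ℝ}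
    (hC : ∀ k ≤ 3, ‖iteratedFDeriv ℝ k F x‖ ≤ C) {k : ℕ} (hk : k ≤ 2) :
    ‖iteratedFDeriv ℝ k (fieldDeriv F) x‖ ≤ 4 * C ^ 2 :=
  norm_iteratedFDeriv_comp_le (hF.fderiv_right (m := 2) (by norm_num)) (hF.of_le (by norm_num))
    (fun k hk => by rw [norm_iteratedFDeriv_fderiv]; exact hC _ (by omega))
    (fun k hk => hC k (by omega)) hk

/-- Three derivatives of `F` are what is required: `fderiv ℝ F` must itself have a Lipschitz
derivative, and `fieldDeriv F`, which already contains one derivative, is then $C^2$. -/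
theorem exists_fieldBound {F : W → V →L[ℝ] W} (hF : ContDiff ℝ 3 F) {U : Set W}
    (hU : Convex ℝ U) {C : ℝ} (hC : ∀ k ≤ 3, ∀ x ∈ U, ‖iteratedFDeriv ℝ k F x‖ ≤ C) :
    ∃ K, FieldBound F U K := by
  have hG := contDiff_fieldDeriv hF
  set K := max 1 (max C (4 * C ^ 2)) with hK
  have h1 : ∀ k ≤ 3, ∀ x ∈ U, ‖iteratedFDeriv ℝ k F x‖ ≤ K := fun k hk x hx =>
    (hC k hk x hx).trans ((le_max_left _ _).trans (le_max_right _ _))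
  have h2 : ∀ k ≤ 2, ∀ x ∈ U, ‖iteratedFDeriv ℝ k (fieldDeriv F) x‖ ≤ K := fun k hk x hx =>
    (norm_iteratedFDeriv_fieldDeriv_le hF (fun k hk => hC k hk x hx) hk).trans
      ((le_max_right _ _).trans (le_max_right _ _))
  refine ⟨K, le_max_left _ _, hU, hF.continuous, hG.continuous, fun x hx => ?_, fun x hx => ?_,
    isC11On_of_contDiff hU (hF.of_le (by norm_num)) fun k _ hk => h1 k (by omega),
    isC11On_of_contDiff hU (hF.fderiv_right (by norm_num)) fun k _ hk x hx => ?_,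
    isC11On_of_contDiff hU hG fun k _ hk => h2 k hk⟩
  · simpa using h1 0 (by norm_num) x hx
  · simpa using h2 0 (by norm_num) x hx
  · rw [norm_iteratedFDeriv_fderiv]
    exact h1 (k + 1) (by omega) x hx

/-- Balls need not be compact in infinite dimensions, so bounds come from continuity at the centre
and hold only on a small ball. -/
theorem exists_fieldBound_closedBall {F : W → V →L[ℝ] W} (hF : ContDiff ℝ 3 F) (x₀ : W) :
    ∃ R > 0, ∃ K, FieldBound F (Metric.closedBall x₀ R) K := by
  have hb : ∀ k : ℕ, k ≤ 3 → ∀ᶠ x in nhds x₀,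
      ‖iteratedFDeriv ℝ k F x‖ ≤ ‖iteratedFDeriv ℝ k F x₀‖ + 1 := fun k hk =>
    ((hF.continuous_iteratedFDeriv (by exact_mod_cast hk)).norm.continuousAt.eventually_lt
      continuousAt_const (by simp)).mono fun x hx => hx.le
  have hb' : ∀ᶠ x in nhds x₀, ∀ k ∈ Finset.range 4,
      ‖iteratedFDeriv ℝ k F x‖ ≤ ‖iteratedFDeriv ℝ k F x₀‖ + 1 := by
    rw [Filter.eventually_all_finset]
    exact fun k hk => hb k (by have := Finset.mem_range.1 hk; omega)
  obtain ⟨R, hR, hball⟩ := Metric.nhds_basis_closedBall.mem_iff.1 hb'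
  refine ⟨R, hR, exists_fieldBound hF (convex_closedBall x₀ R)
    (C := ∑ k ∈ Finset.range 4, (‖iteratedFDeriv ℝ k F x₀‖ + 1)) fun k hk x hx => ?_⟩
  have hk' : k ∈ Finset.range 4 := Finset.mem_range.2 (by omega)
  exact (hball hx k hk').trans (Finset.single_le_sum
    (f := fun k => ‖iteratedFDeriv ℝ k F x₀‖ + 1) (fun k _ => by positivity) hk')

end Field

/-! ### Discrete sewing on a finite grid -/

/-- `s < t` are neighbours in `P`. -/
def Adjacent {ι : Type*} [LT ι] (P : Finset ι) (s t : ι) : Prop :=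
  s ∈ P ∧ t ∈ P ∧ s < t ∧ ∀ u ∈ P, s < u → ¬ u < t

/-- Discrete sewing lemma, in a form which allows for a bootstrap: the defect of additivity over
`i ≤ m < j` has to be controlled only once the claim is known to the left of `j`. -/
theorem discrete_sewing {ι E : Type*} [LinearOrder ι] [NormedAddCommGroup E] (P : Finset ι)
    {p : ι → ℝ} (hp : MonotoneOn p P) {a c ε C : ℝ} (ha : 0 < a) (hc : 0 ≤ c) (hε : 0 ≤ ε)
    (hC0 : 0 ≤ C) (hC : 2 * c + ε + 2 * (1 / 2) ^ a * C ≤ C) {J : ι → ι → E}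
    (hdiag : ∀ i ∈ P, J i i = 0)
    (hstep : ∀ i j, Adjacent P i j → ‖J i j‖ ≤ ε * (p j - p i) ^ a)
    (hδ : ∀ i ∈ P, ∀ m ∈ P, ∀ j ∈ P, i ≤ m → m < j →
      (∀ i' ∈ P, ∀ j' ∈ P, i' ≤ j' → j' < j → ‖J i' j'‖ ≤ C * (p j' - p i') ^ a) →
      ‖J i j - J i m - J m j‖ ≤ c * (p j - p i) ^ a) :
    ∀ i ∈ P, ∀ j ∈ P, i ≤ j → ‖J i j‖ ≤ C * (p j - p i) ^ a := by
  suffices H : ∀ j : P, ∀ i : P, i ≤ j → ‖J i j‖ ≤ C * (p j - p i) ^ a from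
    fun i hi j hj hij => H ⟨j, hj⟩ ⟨i, hi⟩ hij
  intro j
  -- Outer induction moves the right endpoint rightwards; the inner one moves the left endpoint
  -- leftwards with `j` fixed. The outer hypothesis is exactly what `hδ` may use.
  induction j using (wellFounded_lt (α := P)).induction with
  | _ j IHj =>
  have IH : ∀ i' ∈ P, ∀ j' ∈ P, i' ≤ j' → j' < (j : ι) →
      ‖J i' j'‖ ≤ C * (p j' - p i') ^ a := fun i' hi' j' hj' hij hjj =>
    IHj ⟨j', hj'⟩ hjj ⟨i', hi'⟩ hij
  intro i
  induction i using (wellFounded_gt (α := P)).induction with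
  | _ i IHi =>
  intro hij
  obtain ⟨j, hj⟩ := j
  obtain ⟨i, hi⟩ := i
  simp only [Subtype.mk_le_mk, Subtype.forall, Subtype.mk_lt_mk] at IHi IH hij ⊢
  have hpij : p i ≤ p j := hp hi hj hij
  rcases hij.eq_or_lt with rfl | hlt
  · rw [hdiag i hi, norm_zero]
    positivity
  -- `m` is the last grid point before `j` in the left half of the interval and `m'` its successor.
  -- Both $[i,m]$ and $[m',j]$ have length at most $d/2$, so each costs a factor $(1/2)^a$; the gap
  -- between them is a single step.
  set M := P.filter fun u => i ≤ u ∧ u < j ∧ p u ≤ (p i + p j) / 2 with hM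
  have hMne : M.Nonempty := ⟨i, by simp only [hM, Finset.mem_filter]; exact
    ⟨hi, le_rfl, hlt, by linarith⟩⟩
  set m := M.max' hMne with hm
  obtain ⟨hmP, him, hmj, hmid⟩ : m ∈ P ∧ i ≤ m ∧ m < j ∧ p m ≤ (p i + p j) / 2 :=
    Finset.mem_filter.1 (M.max'_mem hMne)
  set M' := P.filter fun u => m < u ∧ u ≤ j with hM'
  have hMne' : M'.Nonempty := ⟨j, by simp only [hM', Finset.mem_filter]; exact ⟨hj, hmj, le_rfl⟩⟩
  set m' := M'.min' hMne' with hm'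
  obtain ⟨hmP', hmm, hmj'⟩ : m' ∈ P ∧ m < m' ∧ m' ≤ j :=
    Finset.mem_filter.1 (M'.min'_mem hMne')
  have hadj : Adjacent P m m' := ⟨hmP, hmP', hmm, fun u hu hmu hum => by
    have : m' ≤ u := M'.min'_le u (by rw [hM', Finset.mem_filter]; exact
      ⟨hu, hmu, hum.le.trans hmj'⟩)
    exact absurd hum this.not_gt⟩
  have pim := hp hi hmP him
  have pmm := hp hmP hmP' hmm.le
  have pmj := hp hmP' hj hmj'
  set d := p j - p i with hd
  have hd0 : 0 ≤ d := by linarith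
  have half : ∀ x, 0 ≤ x → x ≤ d / 2 → C * x ^ a ≤ C * ((1 / 2) ^ a * d ^ a) := by
    intro x hx hxd
    rw [← Real.mul_rpow (by norm_num) hd0]
    exact mul_le_mul_of_nonneg_left (Real.rpow_le_rpow hx (by linarith) ha.le) hC0
  have mono : ∀ e x, 0 ≤ e → 0 ≤ x → x ≤ d → e * x ^ a ≤ e * d ^ a := fun e x he hx hxd =>
    mul_le_mul_of_nonneg_left (Real.rpow_le_rpow hx hxd ha.le) he
  have b1 : ‖J i m‖ ≤ C * ((1 / 2) ^ a * d ^ a) :=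
    (IH i hi m hmP him hmj).trans (half _ (by linarith) (by linarith))
  have b2 : ‖J m m'‖ ≤ ε * d ^ a :=
    (hstep m m' hadj).trans (mono _ _ hε (by linarith) (by linarith))
  have b3 : ‖J m' j‖ ≤ C * ((1 / 2) ^ a * d ^ a) := by
    rcases hmj'.eq_or_lt with h | h
    · rw [h, hdiag j hj, norm_zero]
      positivity
    · refine (IHi m' hmP' (him.trans_lt hmm) hmj').trans (half _ (by linarith) ?_)
      -- If $[m',j]$ were longer than $d/2$, then `m'` would lie in the left half, against the
      -- maximality of `m`.
      by_contra hcon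
      have : m' ≤ m := M.le_max' m' (by
        rw [hM, Finset.mem_filter]
        exact ⟨hmP', him.trans hmm.le, h, by linarith⟩)
      exact absurd hmm this.not_gt
  have b4 : ‖J i j - J i m - J m j‖ ≤ c * d ^ a := hδ i hi m hmP j hj him hmj IH
  have b5 : ‖J m j - J m m' - J m' j‖ ≤ c * d ^ a := by
    rcases hmj'.eq_or_lt with h | h
    · rw [h, hdiag j hj, sub_self, sub_zero, norm_zero]
      positivity
    · exact (hδ m hmP m' hmP' j hj hmm.le h IH).trans (mono _ _ hc (by linarith) (by linarith))
  have e : J i j = (J i j - J i m - J m j) + (J m j - J m m' - J m' j) + J i m + J m m' +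
      J m' j := by abel
  calc ‖J i j‖ ≤ c * d ^ a + c * d ^ a + C * ((1 / 2) ^ a * d ^ a) + ε * d ^ a +
        C * ((1 / 2) ^ a * d ^ a) := by
        rw [e]
        refine (norm_add_le _ _).trans (add_le_add ((norm_add_le _ _).trans (add_le_add
          ((norm_add_le _ _).trans (add_le_add ((norm_add_le _ _).trans (add_le_add b4 b5))
          b1)) b2)) b3)
    _ = (2 * c + ε + 2 * (1 / 2) ^ a * C) * d ^ a := by ring
    _ ≤ C * d ^ a := mul_le_mul_of_nonneg_right hC (by positivity)

theorem two_mul_half_rpow_lt_one {a : ℝ} (ha : 1 < a) : 2 * (1 / 2 : ℝ) ^ a < 1 := by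
  have : (1 / 2 : ℝ) ^ a < (1 / 2) ^ (1 : ℝ) :=
    Real.rpow_lt_rpow_of_exponent_gt (by norm_num) (by norm_num) ha
  rw [Real.rpow_one] at this
  linarith

/-! ### Euler steps and their defect -/

section Step

variable {V W : Type*} [NormedAddCommGroup V] [NormedSpace ℝ V]
  [NormedAddCommGroup W] [NormedSpace ℝ W]

/-- Bounds of a reduced rough path in normalized form. -/
structure PathBound (β T κ : ℝ) (X : ℝ → V) (S : ℝ → ℝ → Tensor2 V) : Prop where
  one_le : 1 ≤ κ
  chen : ∀ s ∈ Set.Icc 0 T, ∀ u ∈ Set.Icc 0 T, ∀ t ∈ Set.Icc 0 T,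
    S s t - S s u - S u t = sym (tmul (X u - X s) (X t - X u))
  fst_le : ∀ s t : ℝ, 0 ≤ s → s ≤ t → t ≤ T → ‖X t - X s‖ ≤ κ * (t - s) ^ β
  snd_le : ∀ s t : ℝ, 0 ≤ s → s ≤ t → t ≤ T → ‖S s t‖ ≤ κ * ((t - s) ^ β) ^ 2

theorem tmul_zero_zero : tmul (0 : V) 0 = 0 := by
  have : PiTensorProduct.tprod ℝ ![(0 : V), 0] = 0 :=
    (PiTensorProduct.tprod ℝ).map_coord_zero 0 (by simp)
  rw [tmul, this]
  exact UniformSpace.Completion.coe_zero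

theorem IsReducedRoughPath.exists_pathBound {β T : ℝ} (hβ : 0 < β) {X : ℝ → V}
    {S : ℝ → ℝ → Tensor2 V} (h : IsReducedRoughPath β T X S) : ∃ κ, PathBound β T κ X S := by
  obtain ⟨C, hC⟩ := h.holder_fst
  obtain ⟨C', hC'⟩ := h.holder_snd
  -- The Hölder bounds only concern $s<t$; the diagonal value comes from Chen's relation at three
  -- equal times.
  have hS : ∀ s ∈ Set.Icc 0 T, S s s = 0 := by
    intro s hs
    have := h.chen s hs s hs s hs
    simpa [tmul_zero_zero, sym] using this
  refine ⟨max 1 (max C C'), le_max_left _ _, h.chen, fun s t hs hst ht => ?_,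
    fun s t hs hst ht => ?_⟩
  · rcases hst.eq_or_lt with rfl | hlt
    · simp [Real.zero_rpow hβ.ne']
    · exact (hC s t hs hlt ht).trans (mul_le_mul_of_nonneg_right
        ((le_max_left _ _).trans (le_max_right _ _)) (Real.rpow_nonneg (by linarith) _))
  · rcases hst.eq_or_lt with rfl | hlt
    · simp [hS s ⟨hs, ht⟩, Real.zero_rpow hβ.ne']
    · rw [← Real.rpow_natCast, ← Real.rpow_mul (by linarith), mul_comm β]
      exact (hC' s t hs hlt ht).trans (mul_le_mul_of_nonneg_right
        ((le_max_right _ _).trans (le_max_right _ _)) (Real.rpow_nonneg (by linarith) _))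

variable [CompleteSpace W]

/-- The increment over `[s, t]` of the second order Euler scheme started at `y`. -/
def eulerStep (F : W → V →L[ℝ] W) (X : ℝ → V) (S : ℝ → ℝ → Tensor2 V) (s t : ℝ) (y : W) : W :=
  F y (X t - X s) + tensorLift (fieldDeriv F y) (S s t)

/-- The residual `Y_{s,t} - F(Y_s) X_{s,t} - DF(Y_s)F(Y_s) S_{s,t}` of Davie's expansion. -/
def residual (F : W → V →L[ℝ] W) (X : ℝ → V) (S : ℝ → ℝ → Tensor2 V) (Y : ℝ → W) (s t : ℝ) : W :=
  Y t - Y s - eulerStep F X S s t (Y s)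

/-- The defect of additivity of Euler steps, with `v = X_{s,u}`, `v' = X_{u,t}`, `σ = S_{u,t}`,
from `x` at time `s` and `y` at time `u`. -/
def stepDefect (F : W → V →L[ℝ] W) (v v' : V) (σ : Tensor2 V) (x y : W) : W :=
  (F y - F x - fderiv ℝ F x (F x v)) v' + tensorLift (fieldDeriv F y - fieldDeriv F x) σ

variable {F : W → V →L[ℝ] W} {X : ℝ → V} {S : ℝ → ℝ → Tensor2 V} {U : Set W} {β T κ K : ℝ}

/-- The cross term of Chen's relation becomes $DF(x)(F(x)v)v'$, the first order correction to
$F(y)-F(x)$. The points `x`, `y` are arbitrary, so the identity serves residuals and Riemann sums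
alike. -/
theorem eulerStep_add_sub (hsymm : HasSymmetricDerivative F) (hX : PathBound β T κ X S) {s u t : ℝ}
    (hs : s ∈ Set.Icc 0 T) (hu : u ∈ Set.Icc 0 T) (ht : t ∈ Set.Icc 0 T) (x y : W) :
    eulerStep F X S s u x + eulerStep F X S u t y - eulerStep F X S s t x =
      stepDefect F (X u - X s) (X t - X u) (S u t) x y := by
  have h1 : S s t = S s u + S u t + sym (tmul (X u - X s) (X t - X u)) := by
    rw [← hX.chen s hs u hu t ht]; abel
  have h2 : X t - X s = (X u - X s) + (X t - X u) := by abel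
  have h3 : tensorLift (fieldDeriv F x) (sym (tmul (X u - X s) (X t - X u))) =
      fderiv ℝ F x (F x (X u - X s)) (X t - X u) :=
    tensorLift_sym_tmul _ (hsymm x) _ _
  rw [eulerStep, eulerStep, eulerStep, stepDefect, h1, h2, map_add, map_add, map_add, h3,
    tensorLift_sub, sub_apply, sub_apply]
  abel

theorem residual_sub_sub (hsymm : HasSymmetricDerivative F) (hX : PathBound β T κ X S)
    (Y : ℝ → W) {s u t : ℝ}
    (hs : s ∈ Set.Icc 0 T) (hu : u ∈ Set.Icc 0 T) (ht : t ∈ Set.Icc 0 T) :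
    residual F X S Y s t - residual F X S Y s u - residual F X S Y u t =
      stepDefect F (X u - X s) (X t - X u) (S u t) (Y s) (Y u) := by
  rw [← eulerStep_add_sub hsymm hX hs hu ht, residual, residual, residual]
  abel

theorem residual_self (hβ : 0 < β) (hX : PathBound β T κ X S) (Y : ℝ → W) {s : ℝ}
    (hs : s ∈ Set.Icc 0 T) : residual F X S Y s s = 0 := by
  have : S s s = 0 := by
    simpa [Real.zero_rpow hβ.ne'] using hX.snd_le s s hs.1 le_rfl hs.2
  simp [residual, eulerStep, this]

/-- The defect splits into a Taylor remainder of `F`, `DF` applied to the controlled remainder, and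
an increment of `fieldDeriv F`. By the four point estimates, each difference is linear in the
distance `ρ` and of third order in `w`. -/
theorem stepDefect_sub_le (hF : FieldBound F U K) (hκ : 0 ≤ κ) {c ρ w : ℝ} (hc : 1 ≤ c)
    (hρ : 0 ≤ ρ) (hw : 0 ≤ w) {v v' : V} {σ : Tensor2 V} (hv' : ‖v'‖ ≤ κ * w)
    (hσ : ‖σ‖ ≤ κ * w ^ 2) {x y x' y' : W} (hx : x ∈ U) (hy : y ∈ U) (hx' : x' ∈ U) (hy' : y' ∈ U)
    (h1 : ‖y - x‖ ≤ c * w) (h1' : ‖y' - x'‖ ≤ c * w)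
    (h2' : ‖y' - x' - F x' v‖ ≤ c * w ^ 2)
    (hxx : ‖x - x'‖ ≤ ρ) (hyy : ‖y - y'‖ ≤ ρ) (h3 : ‖(y - x) - (y' - x')‖ ≤ ρ * w)
    (h4 : ‖(y - x - F x v) - (y' - x' - F x' v)‖ ≤ ρ * w ^ 2) :
    ‖stepDefect F v v' σ x y - stepDefect F v v' σ x' y'‖ ≤
      11 * K * κ * c ^ 2 * ρ * w ^ 3 := by
  have hK : 0 ≤ K := zero_le_one.trans hF.one_le
  have hc0 : 0 ≤ c := zero_le_one.trans hc
  have a1 : ‖(F y - F x - fderiv ℝ F x (y - x)) - (F y' - F x' - fderiv ℝ F x' (y' - x'))‖ ≤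
      K * (c * w) * (ρ * w) + K * (ρ * w + 2 * (ρ + ρ) * (c * w)) * (c * w) :=
    (norm_taylor_sub_taylor_le hF.c11 hF.c11_fderiv hK hF.convex hx hy hx' hy').trans (by gcongr)
  have a2 : ‖fderiv ℝ F x (y - x - F x v) - fderiv ℝ F x' (y' - x' - F x' v)‖ ≤
      K * (ρ * w ^ 2) + K * ρ * (c * w ^ 2) :=
    (norm_apply_sub_apply_le (hF.c11.bound x hx) (hF.c11.lip x' hx' x hx)).trans (by gcongr)
  have a3 : ‖(fieldDeriv F y - fieldDeriv F x) - (fieldDeriv F y' - fieldDeriv F x')‖ ≤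
      K * (ρ * w) + K * (ρ + ρ) * (c * w) :=
    (hF.c11_deriv.norm_sub_sub_sub_le hK hF.convex hx hy hx' hy').trans (by gcongr)
  have e : stepDefect F v v' σ x y - stepDefect F v v' σ x' y' =
      (((F y - F x - fderiv ℝ F x (y - x)) - (F y' - F x' - fderiv ℝ F x' (y' - x'))) +
        (fderiv ℝ F x (y - x - F x v) - fderiv ℝ F x' (y' - x' - F x' v))) v' +
      tensorLift ((fieldDeriv F y - fieldDeriv F x) - (fieldDeriv F y' - fieldDeriv F x')) σ := by
    rw [stepDefect, stepDefect, map_sub (fderiv ℝ F x) (y - x),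
      map_sub (fderiv ℝ F x') (y' - x')]
    simp only [tensorLift_sub, add_apply, sub_apply]
    abel
  rw [e]
  calc _ ≤ ((K * (c * w) * (ρ * w) + K * (ρ * w + 2 * (ρ + ρ) * (c * w)) * (c * w)) +
        (K * (ρ * w ^ 2) + K * ρ * (c * w ^ 2))) * (κ * w) +
        (K * (ρ * w) + K * (ρ + ρ) * (c * w)) * (κ * w ^ 2) := by
        refine (norm_add_le _ _).trans (add_le_add ?_ ?_)
        · refine (ContinuousLinearMap.le_opNorm _ _).trans ?_
          exact mul_le_mul ((norm_add_le _ _).trans (add_le_add a1 a2)) hv' (norm_nonneg _)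
            (by positivity)
        · exact (norm_tensorLift_le _ _).trans (mul_le_mul a3 hσ (norm_nonneg _) (by positivity))
    _ = (2 + 5 * c + 4 * c ^ 2) * (K * κ * ρ * w ^ 3) := by ring
    _ ≤ (11 * c ^ 2) * (K * κ * ρ * w ^ 3) :=
        mul_le_mul_of_nonneg_right (by nlinarith) (by positivity)
    _ = _ := by ring

theorem stepDefect_le (hF : FieldBound F U K) (hκ : 0 ≤ κ) {c w : ℝ} (hc : 1 ≤ c)
    (hw : 0 ≤ w) {v v' : V} {σ : Tensor2 V} (hv' : ‖v'‖ ≤ κ * w)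
    (hσ : ‖σ‖ ≤ κ * w ^ 2) {x y : W} (hx : x ∈ U) (hy : y ∈ U)
    (h1 : ‖y - x‖ ≤ c * w) (h2 : ‖y - x - F x v‖ ≤ c * w ^ 2) :
    ‖stepDefect F v v' σ x y‖ ≤ 3 * K * κ * c ^ 2 * w ^ 3 := by
  have hK : 0 ≤ K := zero_le_one.trans hF.one_le
  have hc0 : 0 ≤ c := zero_le_one.trans hc
  have a1 : ‖F y - F x - fderiv ℝ F x (y - x)‖ ≤ K * (c * w) * (c * w) := by
    -- Collapsing the second pair to a point turns the four point estimate into the usual bound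
    -- $K\|y-x\|^2$.
    have := norm_taylor_sub_taylor_le hF.c11 hF.c11_fderiv hK hF.convex hx hy hx hx
    simp only [sub_self, map_zero, sub_zero, norm_zero, mul_zero, add_zero] at this
    exact this.trans (by gcongr)
  have a2 : ‖fderiv ℝ F x (y - x - F x v)‖ ≤ K * (c * w ^ 2) :=
    (ContinuousLinearMap.le_of_opNorm_le _ (hF.c11.bound x hx) _).trans (by gcongr)
  have a3 : ‖fieldDeriv F y - fieldDeriv F x‖ ≤ K * (c * w) :=
    (hF.c11_deriv.lipschitz hF.convex hx hy).trans (by gcongr)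
  have e : stepDefect F v v' σ x y =
      ((F y - F x - fderiv ℝ F x (y - x)) + fderiv ℝ F x (y - x - F x v)) v' +
        tensorLift (fieldDeriv F y - fieldDeriv F x) σ := by
    rw [stepDefect, map_sub (fderiv ℝ F x) (y - x)]
    abel_nf
  rw [e]
  calc _ ≤ (K * (c * w) * (c * w) + K * (c * w ^ 2)) * (κ * w) +
        (K * (c * w)) * (κ * w ^ 2) := by
        refine (norm_add_le _ _).trans (add_le_add ?_ ?_)
        · refine (ContinuousLinearMap.le_opNorm _ _).trans ?_
          exact mul_le_mul ((norm_add_le _ _).trans (add_le_add a1 a2)) hv' (norm_nonneg _)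
            (by positivity)
        · exact (norm_tensorLift_le _ _).trans (mul_le_mul a3 hσ (norm_nonneg _) (by positivity))
    _ = (2 * c + c ^ 2) * (K * κ * w ^ 3) := by ring
    _ ≤ (3 * c ^ 2) * (K * κ * w ^ 3) :=
        mul_le_mul_of_nonneg_right (by nlinarith) (by positivity)
    _ = _ := by ring

end Step

/-! ### Auxiliary facts on powers and grids -/

theorem rpow_three_mul {d : ℝ} (hd : 0 ≤ d) (β : ℝ) : d ^ (3 * β) = (d ^ β) ^ 3 := by
  rw [← Real.rpow_natCast, ← Real.rpow_mul hd, mul_comm]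
  norm_num

theorem rpow_eq_mul_sq {d β γ : ℝ} (hd : 0 ≤ d) (h : 2 * β ≤ γ) (hβ : 0 < β) :
    d ^ γ = d ^ (γ - 2 * β) * (d ^ β) ^ 2 := by
  have h1 : (d ^ β) ^ 2 = d ^ (2 * β) := by
    rw [← Real.rpow_natCast, ← Real.rpow_mul hd, mul_comm]
    norm_num
  rw [h1, ← Real.rpow_add_of_nonneg hd (by linarith) (by linarith)]
  congr 1
  ring

/-- The filter form lets several smallness conditions on one `h` be combined by `and`. -/
theorem eventually_mul_rpow_le (A : ℝ) {B θ : ℝ} (hB : 0 < B) (hθ : 0 < θ) :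
    ∀ᶠ h : ℝ in nhdsWithin 0 (Set.Ioi 0), A * h ^ θ ≤ B := by
  have h : ContinuousAt (fun h : ℝ => A * h ^ θ) 0 :=
    continuousAt_const.mul (Real.continuousAt_rpow_const 0 θ (Or.inr hθ.le))
  have h0 : A * (0 : ℝ) ^ θ < B := by rwa [Real.zero_rpow hθ.ne', mul_zero]
  exact nhdsWithin_le_nhds ((h.eventually_lt continuousAt_const h0).mono fun x hx => hx.le)

theorem exists_mul_rpow_le (A : ℝ) {B θ : ℝ} (hB : 0 < B) (hθ : 0 < θ) :
    ∃ h > 0, A * h ^ θ ≤ B := by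
  obtain ⟨h, h1, h2⟩ := ((eventually_mul_rpow_le A hB hθ).and self_mem_nhdsWithin).exists
  exact ⟨h, h2, h1⟩

/-- `P` contains points of `[a, b]` within distance `δ` to the right of every point of `[a, b)`. -/
def IsFine (P : Finset ℝ) (a b δ : ℝ) : Prop :=
  ∀ x, a ≤ x → x < b → ∃ u ∈ P, x < u ∧ u ≤ x + δ ∧ u ≤ b

theorem exists_isFine (a b : ℝ) {δ : ℝ} (hδ : 0 < δ) : ∃ P, IsFine P a b δ := by
  refine ⟨(Finset.range (⌊(b - a) / δ⌋₊ + 2)).image fun k : ℕ => min b (a + k * δ),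
    fun x hx hxb => ⟨min b (a + (⌊(x - a) / δ⌋₊ + 1 : ℕ) * δ), ?_, ?_, ?_, min_le_left _ _⟩⟩
  · refine Finset.mem_image_of_mem _ (Finset.mem_range.2 ?_)
    have : ⌊(x - a) / δ⌋₊ ≤ ⌊(b - a) / δ⌋₊ := Nat.floor_mono (by gcongr)
    omega
  · refine lt_min hxb ?_
    have := Nat.lt_floor_add_one ((x - a) / δ)
    rw [div_lt_iff₀ hδ] at this
    push_cast
    linarith
  · refine (min_le_right _ _).trans ?_
    have := Nat.floor_le (div_nonneg (sub_nonneg.2 hx) hδ.le)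
    rw [le_div_iff₀ hδ] at this
    push_cast
    linarith

theorem IsFine.mono {P Q : Finset ℝ} {a b δ : ℝ} (h : IsFine P a b δ) (hPQ : P ⊆ Q) :
    IsFine Q a b δ := fun x hx hxb => by
  obtain ⟨u, hu, h1⟩ := h x hx hxb
  exact ⟨u, hPQ hu, h1⟩

theorem IsFine.sub_le {P : Finset ℝ} {a b δ : ℝ} (h : IsFine P a b δ) {s t : ℝ}
    (hst : Adjacent P s t) (hs : a ≤ s) (ht : t ≤ b) : t - s ≤ δ := by
  obtain ⟨u, hu, h1, h2, -⟩ := h s hs (hst.2.2.1.trans_le ht)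
  have := hst.2.2.2 u hu h1
  linarith

section Local

variable {V W : Type*} [NormedAddCommGroup V] [NormedSpace ℝ V]
  [NormedAddCommGroup W] [NormedSpace ℝ W]
  {F : W → V →L[ℝ] W} {X : ℝ → V} {S : ℝ → ℝ → Tensor2 V} {U : Set W} {β T κ K : ℝ}

/-! ### A priori bounds -/

theorem norm_remainder_le [CompleteSpace W] (hF : FieldBound F U K) (hX : PathBound β T κ X S) {Y : ℝ → W}
    {s t C : ℝ} (hs : 0 ≤ s) (hst : s ≤ t) (ht : t ≤ T) (hY : Y s ∈ U)
    (hr : ‖residual F X S Y s t‖ ≤ C * ((t - s) ^ β) ^ 3) :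
    ‖Y t - Y s - F (Y s) (X t - X s)‖ ≤ (K * κ + C * (t - s) ^ β) * ((t - s) ^ β) ^ 2 := by
  have e : Y t - Y s - F (Y s) (X t - X s) =
      tensorLift (fieldDeriv F (Y s)) (S s t) + residual F X S Y s t := by
    rw [residual, eulerStep]; abel
  have h1 : ‖tensorLift (fieldDeriv F (Y s)) (S s t)‖ ≤ K * (κ * ((t - s) ^ β) ^ 2) :=
    (norm_tensorLift_le _ _).trans (mul_le_mul (hF.norm_deriv_le _ hY) (hX.snd_le s t hs hst ht)
      (norm_nonneg _) (zero_le_one.trans hF.one_le))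
  rw [e]
  refine (norm_add_le _ _).trans ((add_le_add h1 hr).trans (le_of_eq ?_))
  ring

theorem norm_increment_le (hF : FieldBound F U K) (hX : PathBound β T κ X S) {Y : ℝ → W}
    {s t c : ℝ} (hs : 0 ≤ s) (hst : s ≤ t) (ht : t ≤ T) (hY : Y s ∈ U)
    (hr : ‖Y t - Y s - F (Y s) (X t - X s)‖ ≤ c * ((t - s) ^ β) ^ 2) :
    ‖Y t - Y s‖ ≤ (K * κ + c * (t - s) ^ β) * (t - s) ^ β := by
  have e : Y t - Y s = F (Y s) (X t - X s) + (Y t - Y s - F (Y s) (X t - X s)) := by abel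
  have h1 : ‖F (Y s) (X t - X s)‖ ≤ K * (κ * (t - s) ^ β) :=
    (ContinuousLinearMap.le_opNorm _ _).trans (mul_le_mul (hF.norm_le _ hY)
      (hX.fst_le s t hs hst ht) (norm_nonneg _) (zero_le_one.trans hF.one_le))
  rw [e]
  refine (norm_add_le _ _).trans ((add_le_add h1 hr).trans (le_of_eq ?_))
  ring

/-- On `P`, the path `Y` with derivative `F(Y)` is controlled, with constant `c`. -/
def IsControlledOn (β : ℝ) (X : ℝ → V) (F : W → V →L[ℝ] W) (c : ℝ) (P : Set ℝ) (Y : ℝ → W) : Prop :=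
  ∀ s ∈ P, ∀ t ∈ P, s ≤ t → ‖Y t - Y s‖ ≤ c * (t - s) ^ β ∧
    ‖Y t - Y s - F (Y s) (X t - X s)‖ ≤ c * ((t - s) ^ β) ^ 2

variable [CompleteSpace W]

/-- The resulting constant does not involve `C`. This closes the bootstrap without circularity: `C`
is chosen from $3K\kappa$, and only then is the interval shortened until $C|t-s|^\beta\le 1$. -/
theorem norm_le_of_residual_le (hF : FieldBound F U K) (hX : PathBound β T κ X S) {Y : ℝ → W}
    {s t C : ℝ} (hs : 0 ≤ s) (hst : s ≤ t) (ht : t ≤ T) (hY : Y s ∈ U)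
    (hw : (t - s) ^ β ≤ 1) (hC : C * (t - s) ^ β ≤ 1)
    (hr : ‖residual F X S Y s t‖ ≤ C * (t - s) ^ (3 * β)) :
    ‖Y t - Y s‖ ≤ 3 * K * κ * (t - s) ^ β ∧
    ‖Y t - Y s - F (Y s) (X t - X s)‖ ≤ 3 * K * κ * ((t - s) ^ β) ^ 2 := by
  have hw0 : 0 ≤ (t - s) ^ β := Real.rpow_nonneg (by linarith) _
  have h1 : 1 ≤ K * κ := one_le_mul_of_one_le_of_one_le hF.one_le hX.one_le
  rw [rpow_three_mul (by linarith)] at hr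
  have hR := norm_remainder_le hF hX hs hst ht hY hr
  have hR' : ‖Y t - Y s - F (Y s) (X t - X s)‖ ≤ 2 * K * κ * ((t - s) ^ β) ^ 2 :=
    hR.trans (mul_le_mul_of_nonneg_right (by linarith) (by positivity))
  refine ⟨(norm_increment_le hF hX hs hst ht hY hR').trans
    (mul_le_mul_of_nonneg_right ?_ hw0), hR'.trans
    (mul_le_mul_of_nonneg_right (by linarith) (by positivity))⟩
  nlinarith

/-- `Y` is a solution of the second order Euler scheme along the grid `P`. -/
def IsEulerOn (F : W → V →L[ℝ] W) (X : ℝ → V) (S : ℝ → ℝ → Tensor2 V) (P : Finset ℝ)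
    (Y : ℝ → W) : Prop :=
  ∀ s t, Adjacent P s t → Y t = Y s + eulerStep F X S s t (Y s)

theorem exists_isEulerOn (F : W → V →L[ℝ] W) (X : ℝ → V) (S : ℝ → ℝ → Tensor2 V) (x₀ : W)
    (P : Finset ℝ) :
    -- The initial value is prescribed at a least element of `P`, so that the statement is also
    -- meaningful for the empty grid and the induction can start there.
    ∃ Y : ℝ → W, (∀ m ∈ P, (∀ u ∈ P, m ≤ u) → Y m = x₀) ∧ IsEulerOn F X S P Y := by
  induction P using Finset.induction_on_max with
  | empty => exact ⟨fun _ => x₀, by simp, fun s t h => absurd h.1 (Finset.notMem_empty s)⟩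
  | insert t P hmax ih =>
    obtain ⟨Y, hY0, hY⟩ := ih
    rcases P.eq_empty_or_nonempty with rfl | hne
    · refine ⟨fun _ => x₀, fun _ _ _ => rfl, fun u v h => ?_⟩
      have h1 := h.1
      have h2 := h.2.1
      simp only [Finset.mem_insert, Finset.notMem_empty, or_false] at h1 h2
      exact absurd h.2.2.1 (by simp [h1, h2])
    · set m := P.max' hne with hm
      have hmP : m ∈ P := P.max'_mem hne
      have hupd : ∀ s ∈ P, ∀ y, Function.update Y t y s = Y s := fun s hs y =>
        Function.update_of_ne (hmax s hs).ne y Y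
      refine ⟨Function.update Y t (Y m + eulerStep F X S m t (Y m)), fun s hs hmin => ?_,
        fun u v h => ?_⟩
      · rcases Finset.mem_insert.1 hs with rfl | hs
        · exact absurd (hmax m hmP) (hmin m (Finset.mem_insert_of_mem hmP)).not_gt
        · rw [hupd s hs]
          exact hY0 s hs fun u hu => hmin u (Finset.mem_insert_of_mem hu)
      · obtain ⟨hu, hv, huv, hadj⟩ := h
        have huP : u ∈ P := by
          rcases Finset.mem_insert.1 hu with rfl | hu
          · rcases Finset.mem_insert.1 hv with rfl | hv
            · exact absurd huv (lt_irrefl _)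
            · exact absurd huv (hmax v hv).not_gt
          · exact hu
        rw [hupd u huP]
        rcases Finset.mem_insert.1 hv with rfl | hv
        · have : u = m := by
            refine le_antisymm (P.le_max' u huP) (not_lt.1 fun hlt => ?_)
            exact hadj m (Finset.mem_insert_of_mem hmP) hlt (hmax m hmP)
          rw [Function.update_self, this]
        · rw [hupd v hv]
          exact hY u v ⟨huP, hv, huv, fun x hx => hadj x (Finset.mem_insert_of_mem hx)⟩

/-- Residuals vanish on single steps, so sewing runs with `ε = 0`. Bounding the defect up to `t`
requires that the scheme be controlled and stay in `U` before `t`; the residual bounds already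
proved to the left of `t` give both. -/
theorem eulerScheme_bound (hsymm : HasSymmetricDerivative F) (hF : FieldBound F U K)
    (hX : PathBound β T κ X S) (hβ : 0 < β) {C a h R : ℝ} {x₀ : W} (hC0 : 0 ≤ C)
    (hC : 2 * (3 * K * κ * (3 * K * κ) ^ 2) + 2 * (1 / 2) ^ (3 * β) * C ≤ C) (ha : 0 ≤ a)
    (hh0 : 0 ≤ h) (hh : h ≤ 1)
    (hCh : C * h ^ β ≤ 1) (hR : 3 * K * κ * h ^ β ≤ R) (hball : Metric.closedBall x₀ R ⊆ U)
    {P : Finset ℝ} (haP : a ∈ P) (hP : ∀ s ∈ P, a ≤ s ∧ s ≤ a + h ∧ s ≤ T) {Y : ℝ → W}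
    (hYa : Y a = x₀) (hY : IsEulerOn F X S P Y) :
    (∀ s ∈ P, ∀ t ∈ P, s ≤ t → ‖residual F X S Y s t‖ ≤ C * (t - s) ^ (3 * β)) ∧
      ∀ s ∈ P, Y s ∈ Metric.closedBall x₀ R := by
  have hK : 1 ≤ K := hF.one_le
  have hκ : 1 ≤ κ := hX.one_le
  have hKκ : 1 ≤ K * κ := one_le_mul_of_one_le_of_one_le hK hκ
  have hh0β : 0 ≤ h ^ β := Real.rpow_nonneg hh0 _
  have hR0 : 0 ≤ R := le_trans (by positivity) hR
  have hx₀ : x₀ ∈ U := hball (Metric.mem_closedBall_self hR0)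
  have hw : ∀ s ∈ P, ∀ t ∈ P, s ≤ t → (t - s) ^ β ≤ h ^ β := fun s hs t ht hst =>
    Real.rpow_le_rpow (by linarith) (by linarith [(hP s hs).1, (hP t ht).2.1]) hβ.le
  have hh1 : h ^ β ≤ 1 := Real.rpow_le_one hh0 hh hβ.le
  have hctrl : ∀ s ∈ P, ∀ t ∈ P, s ≤ t → Y s ∈ U →
      ‖residual F X S Y s t‖ ≤ C * (t - s) ^ (3 * β) →
      ‖Y t - Y s‖ ≤ 3 * K * κ * (t - s) ^ β ∧
      ‖Y t - Y s - F (Y s) (X t - X s)‖ ≤ 3 * K * κ * ((t - s) ^ β) ^ 2 := by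
    intro s hs t ht hst hYs hr
    have hw' := hw s hs t ht hst
    exact norm_le_of_residual_le hF hX (ha.trans (hP s hs).1) hst (hP t ht).2.2 hYs
      (hw'.trans hh1) ((mul_le_mul_of_nonneg_left hw' hC0).trans hCh) hr
  have hin : ∀ s ∈ P, ‖residual F X S Y a s‖ ≤ C * (s - a) ^ (3 * β) →
      Y s ∈ Metric.closedBall x₀ R := by
    intro s hs hr
    have := (hctrl a haP s hs (hP s hs).1 (by rwa [hYa]) hr).1
    rw [mem_closedBall_iff_norm, ← hYa]
    refine this.trans (le_trans ?_ hR)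
    exact mul_le_mul_of_nonneg_left (hw a haP s hs (hP s hs).1) (by positivity)
  have main := discrete_sewing P (p := id) (J := residual F X S Y) (a := 3 * β)
    (c := 3 * K * κ * (3 * K * κ) ^ 2) (ε := 0) (C := C) (monotone_id.monotoneOn _) (by linarith)
    (by positivity) le_rfl hC0 (by linarith)
    (fun s hs => residual_self hβ hX Y ⟨ha.trans (hP s hs).1, (hP s hs).2.2⟩)
    (fun s t hst => by rw [residual, hY s t hst]; simp)
    (fun s hs u hu t ht hsu hut IH => by
      have hYs := hball (hin s hs (IH a haP s hs (hP s hs).1 (hsu.trans_lt hut)))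
      have hYu := hball (hin u hu (IH a haP u hu (hP u hu).1 hut))
      obtain ⟨h1, h2⟩ := hctrl s hs u hu hsu hYs (IH s hs u hu hsu hut)
      have hs0 := ha.trans (hP s hs).1
      have hu0 := ha.trans (hP u hu).1
      have ht0 := ha.trans (hP t ht).1
      have hT := (hP t ht).2.2
      have w0 : 0 ≤ (t - s) ^ β := Real.rpow_nonneg (by linarith) _
      have w1 : (u - s) ^ β ≤ (t - s) ^ β := Real.rpow_le_rpow (by linarith) (by linarith) hβ.le
      have w2 : (t - u) ^ β ≤ (t - s) ^ β := Real.rpow_le_rpow (by linarith) (by linarith) hβ.le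
      have w10 : 0 ≤ (u - s) ^ β := Real.rpow_nonneg (by linarith) _
      have w20 : 0 ≤ (t - u) ^ β := Real.rpow_nonneg (by linarith) _
      rw [residual_sub_sub hsymm hX Y ⟨hs0, by linarith⟩ ⟨hu0, by linarith⟩ ⟨ht0, hT⟩, id, id,
        rpow_three_mul (by linarith)]
      refine stepDefect_le hF (by linarith) (by linarith) w0
        ((hX.fst_le u t hu0 hut.le hT).trans ?_) ((hX.snd_le u t hu0 hut.le hT).trans ?_) hYs hYu
        (h1.trans ?_) (h2.trans ?_) <;> gcongr)
  exact ⟨main, fun s hs => hin s hs (main a haP s hs (hP s hs).1)⟩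

/-! ### Stability -/

theorem stability (hsymm : HasSymmetricDerivative F) (hF : FieldBound F U K)
    (hX : PathBound β T κ X S) (hβ : 0 < β) {γ : ℝ} (hγ : 2 * β < γ) (hγ' : γ ≤ 3 * β)
    {c a h N ε : ℝ} (hc : 1 ≤ c) (ha : 0 ≤ a)
    (hh0 : 0 ≤ h) (hh : h ≤ 1) (hN0 : 0 ≤ N) (hε : 0 ≤ ε)
    (hN : 66 * K ^ 2 * κ ^ 2 * c ^ 2 * h ^ (γ - 2 * β) * N + ε + 2 * (1 / 2) ^ γ * N ≤ N)
    {P : Finset ℝ} (haP : a ∈ P) (hP : ∀ s ∈ P, a ≤ s ∧ s ≤ a + h ∧ s ≤ T) {Y Z : ℝ → W}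
    (hYZ : Y a = Z a) (hYU : ∀ s ∈ P, Y s ∈ U) (hZU : ∀ s ∈ P, Z s ∈ U)
    (hY : IsControlledOn β X F c P Y) (hZ : IsControlledOn β X F c P Z)
    (hstep : ∀ s t, Adjacent P s t →
      ‖residual F X S Y s t - residual F X S Z s t‖ ≤ ε * (t - s) ^ γ) :
    ∀ t ∈ P, ‖Y t - Z t‖ ≤ N := by
  have hK : 1 ≤ K := hF.one_le
  have hκ : 1 ≤ κ := hX.one_le
  have hKκ : 1 ≤ K * κ := one_le_mul_of_one_le_of_one_le hK hκ
  set η := h ^ (γ - 2 * β) with hη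
  have hη0 : 0 ≤ η := Real.rpow_nonneg hh0 _
  have hη1 : η ≤ 1 := Real.rpow_le_one hh0 hh (by linarith)
  set J : ℝ → ℝ → W := fun s t => residual F X S Y s t - residual F X S Z s t with hJ
  -- With equal starting values the Euler steps from `a` coincide, so `J a s` is the difference of
  -- the paths itself.
  have hJa : ∀ s ∈ P, ‖J a s‖ ≤ N * (s - a) ^ γ → ‖Y s - Z s‖ ≤ N * η := by
    intro s hs hJs
    have e : Y s - Z s = J a s := by
      simp only [hJ, residual, hYZ]; abel
    have := hP s hs
    rw [e]
    refine hJs.trans (mul_le_mul_of_nonneg_left ?_ hN0)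
    refine (Real.rpow_le_rpow (by linarith) (by linarith) (by linarith)).trans
      (?_ : h ^ γ ≤ h ^ (γ - 2 * β))
    exact Real.rpow_le_rpow_of_exponent_ge_of_imp hh0 hh (by linarith) (by intros; linarith)
  have main := discrete_sewing P (p := id) (J := J) (a := γ)
    -- The distance $N\eta$ controls the path difference; $3K\kappa N\eta$ also covers its
    -- increments and controlled remainders. Sewing doubles the defect, whence $66=2\cdot 11\cdot 3$
    -- in `hN`.
    (c := 11 * K * κ * c ^ 2 * (3 * K * κ * (N * η))) (ε := ε) (C := N)
    (monotone_id.monotoneOn _) (by linarith) (by positivity) hε hN0 (by linarith)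
    (fun s hs => by
      have hs' : s ∈ Set.Icc 0 T := ⟨ha.trans (hP s hs).1, (hP s hs).2.2⟩
      simp only [hJ, residual_self hβ hX _ hs', sub_self])
    hstep
    (fun s hs u hu t ht hsu hut IH => by
      have hDs := hJa s hs (IH a haP s hs (hP s hs).1 (hsu.trans_lt hut))
      have hDu := hJa u hu (IH a haP u hu (hP u hu).1 hut)
      have hJsu : ‖J s u‖ ≤ N * (u - s) ^ γ := IH s hs u hu hsu hut
      have hs0 := ha.trans (hP s hs).1
      have hu0 := ha.trans (hP u hu).1
      have ht0 := ha.trans (hP t ht).1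
      have hT := (hP t ht).2.2
      have hd : t - s ≤ h := by linarith [(hP s hs).1, (hP t ht).2.1]
      have w0 : 0 ≤ (t - s) ^ β := Real.rpow_nonneg (by linarith) _
      have w1 : (u - s) ^ β ≤ (t - s) ^ β := Real.rpow_le_rpow (by linarith) (by linarith) hβ.le
      have w2 : (t - u) ^ β ≤ (t - s) ^ β := Real.rpow_le_rpow (by linarith) (by linarith) hβ.le
      have w10 : 0 ≤ (u - s) ^ β := Real.rpow_nonneg (by linarith) _
      have w20 : 0 ≤ (t - u) ^ β := Real.rpow_nonneg (by linarith) _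
      have w11 : (t - s) ^ β ≤ 1 := Real.rpow_le_one (by linarith) (by linarith) hβ.le
      have hJ' : ‖J s u‖ ≤ N * η * ((t - s) ^ β) ^ 2 := by
        refine hJsu.trans ?_
        rw [rpow_eq_mul_sq (by linarith) hγ.le hβ, ← mul_assoc]
        have : (u - s) ^ (γ - 2 * β) ≤ η :=
          Real.rpow_le_rpow (by linarith) (by linarith) (by linarith)
        gcongr
      have e : J s t - J s u - J u t =
          stepDefect F (X u - X s) (X t - X u) (S u t) (Y s) (Y u) -
          stepDefect F (X u - X s) (X t - X u) (S u t) (Z s) (Z u) := by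
        rw [← residual_sub_sub hsymm hX Y ⟨hs0, by linarith⟩ ⟨hu0, by linarith⟩ ⟨ht0, hT⟩,
          ← residual_sub_sub hsymm hX Z ⟨hs0, by linarith⟩ ⟨hu0, by linarith⟩ ⟨ht0, hT⟩]
        simp only [hJ]
        abel
      have e4 : (Y u - Y s - F (Y s) (X u - X s)) - (Z u - Z s - F (Z s) (X u - X s)) =
          tensorLift (fieldDeriv F (Y s) - fieldDeriv F (Z s)) (S s u) + J s u := by
        simp only [hJ, residual, eulerStep, tensorLift_sub]
        abel
      have hr : ‖(Y u - Y s - F (Y s) (X u - X s)) - (Z u - Z s - F (Z s) (X u - X s))‖ ≤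
          2 * K * κ * (N * η) * ((t - s) ^ β) ^ 2 := by
        rw [e4]
        have b1 : ‖tensorLift (fieldDeriv F (Y s) - fieldDeriv F (Z s)) (S s u)‖ ≤
            (K * (N * η)) * (κ * ((t - s) ^ β) ^ 2) := by
          refine (norm_tensorLift_le _ _).trans (mul_le_mul ?_ ?_ (norm_nonneg _) (by positivity))
          · exact (hF.c11_deriv.lipschitz hF.convex (hZU s hs) (hYU s hs)).trans (by gcongr)
          · exact (hX.snd_le s u hs0 hsu (by linarith)).trans (by gcongr)
        have b2 : N * η * ((t - s) ^ β) ^ 2 ≤ (K * κ) * (N * η * ((t - s) ^ β) ^ 2) :=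
          le_mul_of_one_le_left (by positivity) hKκ
        refine (norm_add_le _ _).trans ((add_le_add b1 (hJ'.trans b2)).trans (le_of_eq ?_))
        ring
      have hv : ‖(Y u - Y s) - (Z u - Z s)‖ ≤ 3 * K * κ * (N * η) * (t - s) ^ β := by
        have e5 : (Y u - Y s) - (Z u - Z s) = (F (Y s) - F (Z s)) (X u - X s) +
            ((Y u - Y s - F (Y s) (X u - X s)) - (Z u - Z s - F (Z s) (X u - X s))) := by
          rw [sub_apply]; abel
        have b1 : ‖(F (Y s) - F (Z s)) (X u - X s)‖ ≤ (K * (N * η)) * (κ * (t - s) ^ β) := by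
          refine (ContinuousLinearMap.le_opNorm _ _).trans
            (mul_le_mul ?_ ?_ (norm_nonneg _) (by positivity))
          · exact (hF.c11.lipschitz hF.convex (hZU s hs) (hYU s hs)).trans (by gcongr)
          · exact (hX.fst_le s u hs0 hsu (by linarith)).trans (by gcongr)
        have b2 : 2 * K * κ * (N * η) * ((t - s) ^ β) ^ 2 ≤
            2 * K * κ * (N * η) * (t - s) ^ β :=
          mul_le_mul_of_nonneg_left (by nlinarith) (by positivity)
        rw [e5]
        refine (norm_add_le _ _).trans ((add_le_add b1 (hr.trans b2)).trans (le_of_eq ?_))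
        ring
      have hD' : N * η ≤ 3 * K * κ * (N * η) :=
        le_mul_of_one_le_left (by positivity) (by linarith)
      rw [e]
      refine (stepDefect_sub_le (κ := κ) hF (by linarith) hc (ρ := 3 * K * κ * (N * η)) (by positivity) w0
        ((hX.fst_le u t hu0 hut.le hT).trans (by gcongr))
        ((hX.snd_le u t hu0 hut.le hT).trans (by gcongr)) (hYU s hs) (hYU u hu) (hZU s hs)
        (hZU u hu) ((hY s hs u hu hsu).1.trans (by gcongr)) ((hZ s hs u hu hsu).1.trans (by gcongr))
        ((hZ s hs u hu hsu).2.trans (by gcongr)) (hDs.trans hD') (hDu.trans hD') hv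
        (hr.trans ?_)).trans ?_
      · have : 2 * K * κ ≤ 3 * K * κ := by linarith
        gcongr
      · refine mul_le_mul_of_nonneg_left ?_ (by positivity)
        rw [← rpow_three_mul (d := t - s) (by linarith)]
        exact Real.rpow_le_rpow_of_exponent_ge_of_imp (x := t - s) (by linarith) (by linarith) hγ'
          (by intros; linarith))
  intro t ht
  exact (hJa t ht (main a haP t ht (hP t ht).1)).trans
    (mul_le_of_le_one_right hN0 hη1)

end Local

/-! ### Davie solutions: local uniqueness and existence -/

/-- Davie's expansion holds on `I` with constant `C`. -/
def IsDavieOn {V W : Type*} [NormedAddCommGroup V] [NormedSpace ℝ V]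
    [NormedAddCommGroup W] [NormedSpace ℝ W] [CompleteSpace W] (β : ℝ) (X : ℝ → V)
    (S : ℝ → ℝ → Tensor2 V) (F : W → V →L[ℝ] W) (C : ℝ) (I : Set ℝ) (Y : ℝ → W) : Prop :=
  ∀ s ∈ I, ∀ t ∈ I, s ≤ t → ‖residual F X S Y s t‖ ≤ C * (t - s) ^ (3 * β)

/-- The points of `P` in `[a, b]`, together with `a`. -/
def gridIcc (a b : ℝ) (P : Finset ℝ) : Finset ℝ :=
  insert a (P.filter fun u => a ≤ u ∧ u ≤ b)

theorem mem_gridIcc {a b u : ℝ} {P : Finset ℝ} :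
    u ∈ gridIcc a b P ↔ u = a ∨ u ∈ P ∧ a ≤ u ∧ u ≤ b := by
  simp [gridIcc]

theorem left_mem_gridIcc (a b : ℝ) (P : Finset ℝ) : a ∈ gridIcc a b P :=
  Finset.mem_insert_self _ _

theorem gridIcc_mono {a b : ℝ} {P Q : Finset ℝ} (h : P ⊆ Q) : gridIcc a b P ⊆ gridIcc a b Q :=
  fun _ hu => mem_gridIcc.2 ((mem_gridIcc.1 hu).imp_right fun hu => ⟨h hu.1, hu.2⟩)

theorem gridIcc_subset {a b : ℝ} (hab : a ≤ b) {P : Finset ℝ} {u : ℝ} (hu : u ∈ gridIcc a b P) :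
    u ∈ Set.Icc a b := by
  rcases mem_gridIcc.1 hu with rfl | hu
  · exact ⟨le_rfl, hab⟩
  · exact hu.2

theorem IsFine.gridIcc {a b δ : ℝ} {P : Finset ℝ} (h : IsFine P a b δ) :
    IsFine (gridIcc a b P) a b δ := fun x hx hxb => by
  obtain ⟨u, hu, h1, h2, h3⟩ := h x hx hxb
  exact ⟨u, mem_gridIcc.2 (Or.inr ⟨hu, by linarith, h3⟩), h1, h2, h3⟩

section Local

variable {V W : Type*} [NormedAddCommGroup V] [NormedSpace ℝ V]
  [NormedAddCommGroup W] [NormedSpace ℝ W] [CompleteSpace W]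
  {F : W → V →L[ℝ] W} {X : ℝ → V} {S : ℝ → ℝ → Tensor2 V} {U : Set W} {β T κ K : ℝ}

/-- Stability along grids with neighbouring points closer than `δ`. -/
theorem stability_of_isFine (hsymm : HasSymmetricDerivative F) (hF : FieldBound F U K)
    (hX : PathBound β T κ X S) (hβ : 0 < β) {γ : ℝ} (hγ : 2 * β < γ) (hγ' : γ ≤ 3 * β)
    (hγ1 : 1 < γ) {c a b h C δ : ℝ} (hc : 1 ≤ c) (ha : 0 ≤ a) (hbT : b ≤ T)
    (hbh : b ≤ a + h) (hh0 : 0 ≤ h) (hh : h ≤ 1) (hC : 0 ≤ C) (hδ : 0 ≤ δ)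
    (hsmall : 66 * K ^ 2 * κ ^ 2 * c ^ 2 * h ^ (γ - 2 * β) ≤ (1 - 2 * (1 / 2) ^ γ) / 2)
    {P : Finset ℝ} (haP : a ∈ P) (hP : ∀ s ∈ P, s ∈ Set.Icc a b) (hfine : IsFine P a b δ)
    {Y Z : ℝ → W} (hYZ : Y a = Z a) (hYU : ∀ s ∈ P, Y s ∈ U) (hZU : ∀ s ∈ P, Z s ∈ U)
    (hY : IsControlledOn β X F c P Y) (hZ : IsControlledOn β X F c P Z)
    (hstep : ∀ s t, Adjacent P s t →
      ‖residual F X S Y s t - residual F X S Z s t‖ ≤ C * (t - s) ^ (3 * β)) :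
    ∀ t ∈ P, ‖Y t - Z t‖ ≤ 2 * C / (1 - 2 * (1 / 2) ^ γ) * δ ^ (3 * β - γ) := by
  have hl : 0 < 1 - 2 * (1 / 2 : ℝ) ^ γ := by linarith [two_mul_half_rpow_lt_one hγ1]
  set l := 1 - 2 * (1 / 2 : ℝ) ^ γ with hldef
  -- Half of the sewing margin `l` absorbs the feedback term through `hsmall`; the other half pays
  -- for the steps, since $|t-s|^{3\beta}\le\delta^{3\beta-\gamma}|t-s|^\gamma$ on neighbours.
  set N := 2 * C / l * δ ^ (3 * β - γ) with hN
  have hN0 : 0 ≤ N := by positivity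
  have hNl : N * l = 2 * (C * δ ^ (3 * β - γ)) := by
    rw [hN]; field_simp
  refine stability hsymm hF hX hβ hγ hγ' hc ha hh0 hh hN0
    (ε := C * δ ^ (3 * β - γ)) (by positivity) ?_ haP
    (fun s hs => ⟨(hP s hs).1, (hP s hs).2.trans hbh, (hP s hs).2.trans hbT⟩) hYZ hYU hZU hY hZ
    fun s t hst => (hstep s t hst).trans ?_
  · nlinarith [mul_le_mul_of_nonneg_right hsmall hN0]
  · have hd : 0 < t - s := sub_pos.2 hst.2.2.1
    have e : (t - s) ^ (3 * β) = (t - s) ^ (3 * β - γ) * (t - s) ^ γ := by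
      rw [← Real.rpow_add hd]; congr 1; ring
    rw [e, ← mul_assoc]
    have := Real.rpow_le_rpow hd.le (hfine.sub_le hst (hP s hst.1).1 (hP t hst.2.1).2)
      (sub_nonneg.2 hγ')
    gcongr

/-- The grid is auxiliary: it contains the given time `t`, and letting its mesh tend to zero kills
the bound $O(\delta^{3\beta-\gamma})$. -/
theorem davie_unique (hsymm : HasSymmetricDerivative F) (hF : FieldBound F U K)
    (hX : PathBound β T κ X S) (hβ : 0 < β) {γ : ℝ} (hγ : 2 * β < γ) (hγ' : γ < 3 * β)
    (hγ1 : 1 < γ) {c a b h C : ℝ} (hc : 1 ≤ c) (ha : 0 ≤ a) (hbT : b ≤ T)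
    (hbh : b ≤ a + h) (hh0 : 0 ≤ h) (hh : h ≤ 1) (hC : 0 ≤ C)
    (hsmall : 66 * K ^ 2 * κ ^ 2 * c ^ 2 * h ^ (γ - 2 * β) ≤ (1 - 2 * (1 / 2) ^ γ) / 2)
    {Y Z : ℝ → W} (hYZ : Y a = Z a) (hYU : ∀ s ∈ Set.Icc a b, Y s ∈ U)
    (hZU : ∀ s ∈ Set.Icc a b, Z s ∈ U)
    (hY : IsControlledOn β X F c (Set.Icc a b) Y) (hZ : IsControlledOn β X F c (Set.Icc a b) Z)
    (hYD : IsDavieOn β X S F C (Set.Icc a b) Y) (hZD : IsDavieOn β X S F C (Set.Icc a b) Z) :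
    Set.EqOn Y Z (Set.Icc a b) := by
  intro t ht
  have hab : a ≤ b := ht.1.trans ht.2
  have H : ∀ ε > 0, ‖Y t - Z t‖ ≤ 0 + ε := by
    intro ε hε
    obtain ⟨δ, hδ, hle⟩ := exists_mul_rpow_le (2 * (C + C) / (1 - 2 * (1 / 2) ^ γ)) hε
      (sub_pos.2 hγ')
    obtain ⟨P, hP⟩ := exists_isFine a b hδ
    have hsub : ∀ s ∈ gridIcc a b (insert t P), s ∈ Set.Icc a b := fun s hs =>
      gridIcc_subset hab hs
    rw [zero_add]
    refine (stability_of_isFine hsymm hF hX hβ hγ hγ'.le hγ1 hc ha hbT hbh hh0 hh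
      (add_nonneg hC hC) hδ.le hsmall (left_mem_gridIcc a b (insert t P)) hsub
      (hP.mono (Finset.subset_insert t P)).gridIcc hYZ (fun s hs => hYU s (hsub s hs))
      (fun s hs => hZU s (hsub s hs))
      (fun s hs t ht => hY s (hsub s hs) t (hsub t ht))
      (fun s hs t ht => hZ s (hsub s hs) t (hsub t ht)) (fun s u hsu => ?_) t
      (mem_gridIcc.2 (Or.inr ⟨Finset.mem_insert_self _ _, ht⟩))).trans hle
    rw [add_mul]
    exact (norm_sub_le _ _).trans (add_le_add
      (hYD s (hsub s hsu.1) u (hsub u hsu.2.1) hsu.2.2.1.le)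
      (hZD s (hsub s hsu.1) u (hsub u hsu.2.1) hsu.2.2.1.le))
  have := le_of_forall_pos_le_add H
  exact sub_eq_zero.1 (norm_le_zero_iff.1 this)

theorem tendsto_norm_sub_mul {A G : Type*} [TopologicalSpace A] [NormedAddCommGroup G] {g : A → G}
    (hg : Continuous g) (x : A) (c : ℝ) :
    Filter.Tendsto (fun y => ‖g y - g x‖ * c) (nhds x) (nhds 0) := by
  have h1 : Continuous fun y => ‖g y - g x‖ * c := by fun_prop
  simpa using h1.tendsto x

theorem continuous_eulerStep (hF : FieldBound F U K) (s t : ℝ) :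
    Continuous (eulerStep F X S s t) := by
  refine (hF.cont.clm_apply continuous_const).add ?_
  refine continuous_iff_continuousAt.2 fun x => ?_
  rw [ContinuousAt, tendsto_iff_norm_sub_tendsto_zero]
  refine squeeze_zero (fun _ => norm_nonneg _) (fun y => ?_)
    (tendsto_norm_sub_mul (G := V →L[ℝ] V →L[ℝ] W) hF.cont_deriv x ‖S s t‖)
  rw [← tensorLift_sub]
  exact norm_tensorLift_le _ _

/-- The solution is the pointwise limit of Euler schemes along the net of all finite sets of times,
ordered by inclusion. The net is Cauchy, so no compactness of `W` is used; every time of $[a,b]$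
eventually lies on the grid, so bounds valid on grids pass to the limit. -/
theorem exists_davie_of_small (hsymm : HasSymmetricDerivative F) (hF : FieldBound F U K)
    (hX : PathBound β T κ X S) (hβ : 0 < β) {γ : ℝ} (hγ : 2 * β < γ) (hγ' : γ < 3 * β)
    (hγ1 : 1 < γ) {a b h C R : ℝ} {x₀ : W} (hC0 : 0 ≤ C)
    (hC : 2 * (3 * K * κ * (3 * K * κ) ^ 2) + 2 * (1 / 2) ^ (3 * β) * C ≤ C) (ha : 0 ≤ a)
    (hab : a ≤ b) (hbT : b ≤ T) (hbh : b ≤ a + h) (hh0 : 0 ≤ h) (hh : h ≤ 1)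
    (hCh : C * h ^ β ≤ 1) (hR : 3 * K * κ * h ^ β ≤ R) (hball : Metric.closedBall x₀ R ⊆ U)
    (hsmall : 66 * K ^ 2 * κ ^ 2 * (3 * K * κ) ^ 2 * h ^ (γ - 2 * β) ≤
      (1 - 2 * (1 / 2) ^ γ) / 2) :
    ∃ Y : ℝ → W, Y a = x₀ ∧ (∀ s ∈ Set.Icc a b, Y s ∈ Metric.closedBall x₀ R) ∧
      IsDavieOn β X S F C (Set.Icc a b) Y := by
  have hKκ : 1 ≤ K * κ := one_le_mul_of_one_le_of_one_le hF.one_le hX.one_le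
  have hexists : ∀ P : Finset ℝ, ∃ Y : ℝ → W, Y a = x₀ ∧ IsEulerOn F X S (gridIcc a b P) Y := by
    intro P
    obtain ⟨Y, hY0, hY⟩ := exists_isEulerOn F X S x₀ (gridIcc a b P)
    exact ⟨Y, hY0 a (left_mem_gridIcc a b P) fun u hu => (gridIcc_subset hab hu).1, hY⟩
  choose E hEa hE using hexists
  have hbound : ∀ P : Finset ℝ,
      (∀ s ∈ gridIcc a b P, ∀ t ∈ gridIcc a b P, s ≤ t →
        ‖residual F X S (E P) s t‖ ≤ C * (t - s) ^ (3 * β)) ∧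
      ∀ s ∈ gridIcc a b P, E P s ∈ Metric.closedBall x₀ R := fun P =>
    eulerScheme_bound hsymm hF hX hβ hC0 hC ha hh0 hh hCh hR hball (left_mem_gridIcc a b P)
      (fun s hs => ⟨(gridIcc_subset hab hs).1, (gridIcc_subset hab hs).2.trans hbh,
        (gridIcc_subset hab hs).2.trans hbT⟩) (hEa P) (hE P)
  have hctrl : ∀ P : Finset ℝ, IsControlledOn β X F (3 * K * κ) (gridIcc a b P) (E P) := by
    intro P s hs t ht hst
    have hs' := gridIcc_subset hab hs
    have ht' := gridIcc_subset hab ht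
    have hw : (t - s) ^ β ≤ h ^ β := Real.rpow_le_rpow (by linarith) (by linarith [hs'.1, ht'.2])
      hβ.le
    exact norm_le_of_residual_le hF hX (ha.trans hs'.1) hst (ht'.2.trans hbT)
      (hball ((hbound P).2 s hs)) (hw.trans (Real.rpow_le_one hh0 hh hβ.le))
      ((mul_le_mul_of_nonneg_left hw hC0).trans hCh) ((hbound P).1 s hs t ht hst)
  have hcauchy : ∀ t ∈ Set.Icc a b, CauchySeq fun P => E P t := by
    intro t ht
    rw [Metric.cauchySeq_iff']
    intro ε hε
    obtain ⟨δ, hδ, hle⟩ := exists_mul_rpow_le (2 * C / (1 - 2 * (1 / 2) ^ γ)) (half_pos hε)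
      (sub_pos.2 hγ')
    obtain ⟨P, hP⟩ := exists_isFine a b hδ
    -- The finer scheme is compared with the coarser only at coarse grid points. There one step of
    -- the coarse scheme has zero residual and the fine scheme has residual $O(|t-s|^{3\beta})$.
    refine ⟨insert t P, fun Q hQ => ?_⟩
    have hsub := gridIcc_mono (a := a) (b := b) hQ
    rw [dist_comm, dist_eq_norm]
    refine ((stability_of_isFine hsymm hF hX hβ hγ hγ'.le hγ1 (c := 3 * K * κ) (by linarith) ha
      hbT hbh hh0 hh hC0 hδ.le hsmall (left_mem_gridIcc a b (insert t P))
      (fun s hs => gridIcc_subset hab hs)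
      (hP.mono (Finset.subset_insert t P)).gridIcc ((hEa _).trans (hEa _).symm)
      (fun s hs => hball ((hbound _).2 s hs)) (fun s hs => hball ((hbound _).2 s (hsub hs)))
      (hctrl _) (fun s hs t ht => hctrl Q s (hsub hs) t (hsub ht)) (fun s u hsu => ?_) t
      (mem_gridIcc.2 (Or.inr ⟨Finset.mem_insert_self _ _, ht⟩))).trans hle).trans_lt
      (half_lt_self hε)
    have h0 : residual F X S (E (insert t P)) s u = 0 := by
      rw [residual, hE _ s u hsu]; simp
    rw [h0, zero_sub, norm_neg]
    exact (hbound Q).1 s (hsub hsu.1) u (hsub hsu.2.1) hsu.2.2.1.le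
  have hlim : ∀ t, ∃ y, t ∈ Set.Icc a b →
      Filter.Tendsto (fun P => E P t) Filter.atTop (nhds y) := fun t => by
    by_cases ht : t ∈ Set.Icc a b
    · obtain ⟨y, hy⟩ := cauchySeq_tendsto_of_complete (hcauchy t ht)
      exact ⟨y, fun _ => hy⟩
    · exact ⟨0, fun h => absurd h ht⟩
  choose Y hY using hlim
  have hev : ∀ t ∈ Set.Icc a b, ∀ᶠ P in Filter.atTop, t ∈ gridIcc a b P := fun t ht =>
    (Filter.eventually_ge_atTop {t}).mono fun P hP =>
      mem_gridIcc.2 (Or.inr ⟨hP (Finset.mem_singleton_self t), ht⟩)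
  refine ⟨Y, ?_, fun s hs => ?_, fun s hs t ht hst => ?_⟩
  · refine tendsto_nhds_unique (hY a ⟨le_rfl, hab⟩) ?_
    simp only [hEa]
    exact tendsto_const_nhds
  · exact Metric.isClosed_closedBall.mem_of_tendsto (hY s hs)
      ((hev s hs).mono fun P hP => (hbound P).2 s hP)
  · have hlim : Filter.Tendsto (fun P => residual F X S (E P) s t) Filter.atTop
        (nhds (residual F X S Y s t)) :=
      ((hY t ht).sub (hY s hs)).sub (((continuous_eulerStep hF s t).tendsto _).comp (hY s hs))
    exact le_of_tendsto hlim.norm (((hev s hs).and (hev t ht)).mono fun P hP =>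
      (hbound P).1 s hP.1 t hP.2 hst)

theorem exists_exponent (hβ : 1 / 3 < β) (hβ' : β ≤ 1 / 2) :
    ∃ γ, 1 < γ ∧ 2 * β < γ ∧ γ < 3 * β :=
  ⟨(1 + 3 * β) / 2, by linarith, by linarith, by linarith⟩

/-- Local existence of Davie solutions; the length of the interval depends only on the bounds. -/
theorem exists_davie_local (hβ : 1 / 3 < β) (hβ' : β ≤ 1 / 2) (hsymm : HasSymmetricDerivative F)
    (hX : PathBound β T κ X S) (hK : 1 ≤ K) {R : ℝ} (hR : 0 < R) :
    ∃ h > 0, ∃ C ≥ 0, ∀ (U : Set W) (x₀ : W) (a b : ℝ), FieldBound F U K → 0 ≤ a → a ≤ b → b ≤ T →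
      b ≤ a + h → Metric.closedBall x₀ R ⊆ U →
      ∃ Y : ℝ → W, Y a = x₀ ∧ (∀ s ∈ Set.Icc a b, Y s ∈ Metric.closedBall x₀ R) ∧
        IsDavieOn β X S F C (Set.Icc a b) Y := by
  obtain ⟨γ, hγ1, hγ, hγ'⟩ := exists_exponent hβ hβ'
  have hβ0 : 0 < β := by linarith
  have hκ := hX.one_le
  have hl : 0 < 1 - 2 * (1 / 2 : ℝ) ^ (3 * β) := by
    linarith [two_mul_half_rpow_lt_one (a := 3 * β) (by linarith)]
  have hl' : 0 < 1 - 2 * (1 / 2 : ℝ) ^ γ := by linarith [two_mul_half_rpow_lt_one hγ1]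
  -- The value giving equality in the sewing condition with defect constant $3K\kappa c^2$,
  -- $c=3K\kappa$.
  set C := 2 * (3 * K * κ * (3 * K * κ) ^ 2) / (1 - 2 * (1 / 2 : ℝ) ^ (3 * β)) with hC
  have hCl : C * (1 - 2 * (1 / 2 : ℝ) ^ (3 * β)) = 2 * (3 * K * κ * (3 * K * κ) ^ 2) :=
    div_mul_cancel₀ _ hl.ne'
  have hC0 : 0 ≤ C := by positivity
  obtain ⟨h, ⟨⟨⟨h1, h2⟩, h3⟩, h4⟩, h5⟩ :=
    (((((eventually_mul_rpow_le C one_pos hβ0).and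
      (eventually_mul_rpow_le (3 * K * κ) hR hβ0)).and
      (eventually_mul_rpow_le (66 * K ^ 2 * κ ^ 2 * (3 * K * κ) ^ 2) (half_pos hl')
        (sub_pos.2 hγ))).and
      -- With exponent one this is the condition $h\le 1$.
      (eventually_mul_rpow_le 1 one_pos one_pos)).and self_mem_nhdsWithin).exists
  rw [Real.rpow_one, one_mul] at h4
  refine ⟨h, h5, C, hC0, fun U x₀ a b hF ha hab hbT hbh hball => ?_⟩
  exact exists_davie_of_small hsymm hF hX hβ0 hγ hγ' hγ1 hC0 (by linarith) ha hab hbT hbh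
    (le_of_lt h5) h4 h1 h2 hball h3

end Local

/-! ### Partitions -/

theorem IsPartition.mono {t : ℝ} {n : ℕ} {p : ℕ → ℝ} (hp : IsPartition t n p) {i j : ℕ}
    (hij : i ≤ j) (hj : j ≤ n) : p i ≤ p j := by
  induction j, hij using Nat.le_induction with
  | base => exact le_rfl
  | succ j hij ih => exact (ih (by omega)).trans (hp.2.2 j (by omega)).le

theorem IsPartition.mem_Icc {t : ℝ} {n : ℕ} {p : ℕ → ℝ} (hp : IsPartition t n p) {i : ℕ}
    (hi : i ≤ n) : p i ∈ Set.Icc 0 t :=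
  ⟨hp.1 ▸ hp.mono (Nat.zero_le i) hi, hp.2.1 ▸ hp.mono hi le_rfl⟩

theorem exists_fine_sequence {s t : ℝ} (hst : s < t) {δ : ℝ} (hδ : 0 < δ) :
    ∃ (m : ℕ) (q : ℕ → ℝ), q 0 = s ∧ q m = t ∧ ∀ k, q k < q (k + 1) ∧ q (k + 1) - q k < δ := by
  obtain ⟨m, hm⟩ := exists_nat_gt ((t - s) / δ)
  have hd : 0 < t - s := sub_pos.2 hst
  have hm0 : (0 : ℝ) < m := (div_pos hd hδ).trans hm
  refine ⟨m, fun k => s + k * ((t - s) / m), by simp, by field_simp; ring, fun k => ?_⟩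
  have h1 : 0 < (t - s) / m := div_pos hd hm0
  have h2 : (t - s) / m < δ := by
    rw [div_lt_iff₀ hδ] at hm
    rw [div_lt_iff₀ hm0]
    linarith
  push_cast
  constructor <;> linarith

theorem exists_fine_partition {t : ℝ} (ht : 0 ≤ t) {δ : ℝ} (hδ : 0 < δ) :
    ∃ (n : ℕ) (p : ℕ → ℝ), IsPartition t n p ∧ ∀ i < n, p (i + 1) - p i < δ := by
  rcases ht.eq_or_lt with rfl | ht
  · exact ⟨0, fun _ => 0, ⟨rfl, rfl, by simp⟩, by simp⟩
  · obtain ⟨m, q, h0, hm, hq⟩ := exists_fine_sequence ht hδ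
    exact ⟨m, q, ⟨h0, hm, fun i _ => (hq i).1⟩, fun i _ => (hq i).2⟩

/-- If Riemann sums of `f` over `[0, s]` and `[0, t]` converge to `A` and `B`, then suitable Riemann
sums over `[s, t]` are close to `B - A`. -/
theorem exists_riemann_sum_sub_lt {W : Type*} [NormedAddCommGroup W] {f : ℝ → ℝ → W} {s t : ℝ}
    {A B : W} (hs : 0 ≤ s) (hst : s < t)
    (hA : ∀ ε > 0, ∃ δ > 0, ∀ (n : ℕ) (p : ℕ → ℝ), IsPartition s n p →
      (∀ i < n, p (i + 1) - p i < δ) → ‖∑ i ∈ Finset.range n, f (p i) (p (i + 1)) - A‖ < ε)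
    (hB : ∀ ε > 0, ∃ δ > 0, ∀ (n : ℕ) (p : ℕ → ℝ), IsPartition t n p →
      (∀ i < n, p (i + 1) - p i < δ) → ‖∑ i ∈ Finset.range n, f (p i) (p (i + 1)) - B‖ < ε)
    {ε : ℝ} (hε : 0 < ε) :
    ∃ (m : ℕ) (q : ℕ → ℝ), q 0 = s ∧ q m = t ∧ Monotone q ∧
      ‖∑ i ∈ Finset.range m, f (q i) (q (i + 1)) - (B - A)‖ < ε := by
  obtain ⟨δ₁, hδ₁, h₁⟩ := hA (ε / 2) (half_pos hε)
  obtain ⟨δ₂, hδ₂, h₂⟩ := hB (ε / 2) (half_pos hε)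
  obtain ⟨n, p, hp, hpδ⟩ := exists_fine_partition hs (lt_min hδ₁ hδ₂)
  obtain ⟨m, q, hq0, hqm, hq⟩ := exists_fine_sequence hst hδ₂
  -- Concatenation of the two partitions; they share the point `s` at index `n`. The part over
  -- $[0,s]$ is fine enough for both limits, so subtracting its sum leaves a sum over $[s,t]$.
  set r : ℕ → ℝ := fun k => if k ≤ n then p k else q (k - n) with hr
  have hrp : ∀ k ≤ n, r k = p k := fun k hk => if_pos hk
  have hrq : ∀ k, r (n + k) = q k := by
    intro k
    rcases Nat.eq_zero_or_pos k with rfl | hk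
    · rw [add_zero, hrp n le_rfl, hp.2.1, hq0]
    · simp only [hr]
      rw [if_neg (by omega), Nat.add_sub_cancel_left]
  have hrstep : ∀ k < n + m, r k < r (k + 1) ∧ r (k + 1) - r k < δ₂ := by
    intro k hk
    rcases lt_or_ge k n with hkn | hkn
    · rw [hrp k hkn.le, hrp (k + 1) hkn]
      exact ⟨hp.2.2 k hkn, (hpδ k hkn).trans_le (min_le_right _ _)⟩
    · obtain ⟨j, rfl⟩ := Nat.exists_eq_add_of_le hkn
      rw [add_assoc, hrq, hrq]
      exact hq j
  have hrpart : IsPartition t (n + m) r :=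
    ⟨by rw [hrp 0 (Nat.zero_le n), hp.1], by rw [hrq, hqm], fun k hk => (hrstep k hk).1⟩
  have e1 := h₁ n p hp fun i hi => (hpδ i hi).trans_le (min_le_left _ _)
  have e2 := h₂ (n + m) r hrpart fun k hk => (hrstep k hk).2
  rw [Finset.sum_range_add] at e2
  have e3 : ∑ i ∈ Finset.range n, f (r i) (r (i + 1)) =
      ∑ i ∈ Finset.range n, f (p i) (p (i + 1)) := Finset.sum_congr rfl fun i hi => by
    have := Finset.mem_range.1 hi
    rw [hrp i this.le, hrp (i + 1) this]
  have e4 : ∑ i ∈ Finset.range m, f (r (n + i)) (r (n + i + 1)) =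
      ∑ i ∈ Finset.range m, f (q i) (q (i + 1)) := Finset.sum_congr rfl fun i _ => by
    rw [add_assoc, hrq, hrq]
  rw [e3, e4] at e2
  refine ⟨m, q, hq0, hqm, monotone_nat_of_le_succ fun k => (hq k).1.le, ?_⟩
  have e5 : ∑ i ∈ Finset.range m, f (q i) (q (i + 1)) - (B - A) =
      (∑ i ∈ Finset.range n, f (p i) (p (i + 1)) + ∑ i ∈ Finset.range m, f (q i) (q (i + 1)) - B) -
      (∑ i ∈ Finset.range n, f (p i) (p (i + 1)) - A) := by abel
  rw [e5]
  exact (norm_sub_le _ _).trans_lt (by linarith)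

section Solution

variable {V W : Type*} [NormedAddCommGroup V] [NormedSpace ℝ V]
  [NormedAddCommGroup W] [NormedSpace ℝ W]
  {F : W → V →L[ℝ] W} {X : ℝ → V} {S : ℝ → ℝ → Tensor2 V} {U : Set W} {β T κ K : ℝ}

/-! ### Solutions satisfy Davie's expansion -/

theorem IsControlledOn.mono {c : ℝ} {P Q : Set ℝ} {Y : ℝ → W} (h : IsControlledOn β X F c Q Y)
    (hPQ : P ⊆ Q) : IsControlledOn β X F c P Y :=
  fun s hs t ht hst => h s (hPQ hs) t (hPQ ht) hst

theorem IsControlledOn.mono_const {c c' : ℝ} {P : Set ℝ} {Y : ℝ → W}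
    (h : IsControlledOn β X F c P Y) (hc : c ≤ c') : IsControlledOn β X F c' P Y :=
  fun s hs t ht hst =>
    ⟨(h s hs t ht hst).1.trans (mul_le_mul_of_nonneg_right hc
      (Real.rpow_nonneg (sub_nonneg.2 hst) _)),
    (h s hs t ht hst).2.trans (mul_le_mul_of_nonneg_right hc (sq_nonneg _))⟩

theorem IsControlledOn.continuousOn (hβ : 0 < β) {c : ℝ} {I : Set ℝ} {Y : ℝ → W}
    (h : IsControlledOn β X F c I Y) : ContinuousOn Y I := by
  have habs : ∀ s ∈ I, ∀ t ∈ I, ‖Y t - Y s‖ ≤ c * |t - s| ^ β := by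
    intro s hs t ht
    rcases le_total s t with hst | hst
    · rw [abs_of_nonneg (sub_nonneg.2 hst)]
      exact (h s hs t ht hst).1
    · rw [abs_sub_comm, abs_of_nonneg (sub_nonneg.2 hst), norm_sub_rev]
      exact (h t ht s hs hst).1
  intro s hs
  rw [ContinuousWithinAt, tendsto_iff_norm_sub_tendsto_zero]
  have h0 : ContinuousAt (fun t : ℝ => c * |t - s| ^ β) s :=
    continuousAt_const.mul (ContinuousAt.rpow_const (by fun_prop) (Or.inr hβ.le))
  have h1 := h0.tendsto
  simp only [sub_self, abs_zero, Real.zero_rpow hβ.ne', mul_zero] at h1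
  exact squeeze_zero' (Filter.Eventually.of_forall fun _ => norm_nonneg _)
    (eventually_nhdsWithin_of_forall fun t ht => habs s hs t ht) (h1.mono_left nhdsWithin_le_nhds)

variable [CompleteSpace W]

theorem IsSolution.exists_isControlledOn {τ : ℝ} {ξ : W} (hβ : 0 < β) {Y : ℝ → W}
    {Y' : ℝ → V →L[ℝ] W} (h : IsSolution β τ X S F ξ Y Y') :
    ∃ c ≥ 1, IsControlledOn β X F c (Set.Icc 0 τ) Y := by
  obtain ⟨C, hC⟩ := h.controlled.holder
  obtain ⟨C', hC'⟩ := h.controlled.holder_remainder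
  refine ⟨max 1 (max C C'), le_max_left _ _, fun s hs t ht hst => ?_⟩
  rcases hst.eq_or_lt with rfl | hlt
  · simp [Real.zero_rpow hβ.ne']
  · have h1 := hC s t hs.1 hlt ht.2
    have h2 := hC' s t hs.1 hlt ht.2
    simp only [h.deriv_eq s hs] at h2
    refine ⟨h1.trans (mul_le_mul_of_nonneg_right
      ((le_max_left _ _).trans (le_max_right _ _)) (Real.rpow_nonneg (by linarith) _)), ?_⟩
    rw [← Real.rpow_natCast, ← Real.rpow_mul (by linarith), mul_comm β]
    exact h2.trans (mul_le_mul_of_nonneg_right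
      ((le_max_right _ _).trans (le_max_right _ _)) (Real.rpow_nonneg (by linarith) _))

theorem eulerStep_self (hβ : 0 < β) (hX : PathBound β T κ X S) (y : W) {s : ℝ}
    (hs : s ∈ Set.Icc 0 T) : eulerStep F X S s s y = 0 := by
  have : S s s = 0 := by
    simpa [Real.zero_rpow hβ.ne'] using hX.snd_le s s hs.1 le_rfl hs.2
  simp [eulerStep, this]

theorem norm_stepDefect_le_of_controlled (hF : FieldBound F U K) (hX : PathBound β T κ X S)
    (hβ : 0 < β) {c : ℝ} (hc : 1 ≤ c) {I : Set ℝ} {Y : ℝ → W} (hY : IsControlledOn β X F c I Y)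
    {s u t : ℝ} (hs : 0 ≤ s) (hsu : s ≤ u) (hut : u ≤ t) (ht : t ≤ T) (hsI : s ∈ I) (huI : u ∈ I)
    (hYs : Y s ∈ U) (hYu : Y u ∈ U) :
    ‖stepDefect F (X u - X s) (X t - X u) (S u t) (Y s) (Y u)‖ ≤
      3 * K * κ * c ^ 2 * (t - s) ^ (3 * β) := by
  have hκ := hX.one_le
  obtain ⟨h1, h2⟩ := hY s hsI u huI hsu
  have w0 : 0 ≤ (t - s) ^ β := Real.rpow_nonneg (by linarith) _
  have w1 : (u - s) ^ β ≤ (t - s) ^ β := Real.rpow_le_rpow (by linarith) (by linarith) hβ.le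
  have w2 : (t - u) ^ β ≤ (t - s) ^ β := Real.rpow_le_rpow (by linarith) (by linarith) hβ.le
  have w10 : 0 ≤ (u - s) ^ β := Real.rpow_nonneg (by linarith) _
  have w20 : 0 ≤ (t - u) ^ β := Real.rpow_nonneg (by linarith) _
  rw [rpow_three_mul (by linarith)]
  refine stepDefect_le hF (by linarith) hc w0
    ((hX.fst_le u t (by linarith) hut ht).trans ?_)
    ((hX.snd_le u t (by linarith) hut ht).trans ?_) hYs hYu
    (h1.trans ?_) (h2.trans ?_) <;> gcongr

/-- Sewing is applied to partition indices, with times `q` as positions. The path is already known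
to be controlled, so no bootstrap is needed. -/
theorem norm_riemann_sum_sub_le (hsymm : HasSymmetricDerivative F) (hF : FieldBound F U K)
    (hX : PathBound β T κ X S) (hβ : 0 < β) {a b c C : ℝ} (hc : 1 ≤ c) (ha : 0 ≤ a) (hb : b ≤ T)
    {Y : ℝ → W} (hY : IsControlledOn β X F c (Set.Icc a b) Y) (hYU : ∀ s ∈ Set.Icc a b, Y s ∈ U)
    (hC0 : 0 ≤ C) (hC : 2 * (3 * K * κ * c ^ 2) + 2 * (1 / 2) ^ (3 * β) * C ≤ C)
    {m : ℕ} {q : ℕ → ℝ} (hq : Monotone q) (hq0 : a ≤ q 0) (hqm : q m ≤ b) :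
    ‖∑ i ∈ Finset.range m, eulerStep F X S (q i) (q (i + 1)) (Y (q i)) -
      eulerStep F X S (q 0) (q m) (Y (q 0))‖ ≤ C * (q m - q 0) ^ (3 * β) := by
  have hκ := hX.one_le
  have hK := hF.one_le
  set A : ℕ → W := fun j => ∑ i ∈ Finset.range j, eulerStep F X S (q i) (q (i + 1)) (Y (q i))
    with hA
  have hmem : ∀ i ∈ Finset.range (m + 1), q i ∈ Set.Icc a b := fun i hi =>
    ⟨hq0.trans (hq (Nat.zero_le i)), (hq (Nat.lt_succ_iff.1 (Finset.mem_range.1 hi))).trans hqm⟩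
  have hmemT : ∀ i ∈ Finset.range (m + 1), q i ∈ Set.Icc 0 T := fun i hi =>
    ⟨ha.trans (hmem i hi).1, (hmem i hi).2.trans hb⟩
  have main := discrete_sewing (Finset.range (m + 1)) (p := q) (a := 3 * β)
    (J := fun i j => A j - A i - eulerStep F X S (q i) (q j) (Y (q i)))
    (c := 3 * K * κ * c ^ 2) (ε := 0) (C := C) (hq.monotoneOn _) (by linarith) (by positivity)
    le_rfl hC0 (by linarith)
    (fun i hi => by simp only [sub_self, eulerStep_self hβ hX _ (hmemT i hi)])
    (fun i j hij => by
      obtain rfl : j = i + 1 := by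
        by_contra hne
        have hj := Finset.mem_range.1 hij.2.1
        have hlt := hij.2.2.1
        exact hij.2.2.2 (i + 1) (Finset.mem_range.2 (by omega)) (by omega) (by omega)
      simp [hA, Finset.sum_range_succ])
    (fun i hi k hk j hj hik hkj _ => by
      have e : A j - A i - eulerStep F X S (q i) (q j) (Y (q i)) -
          (A k - A i - eulerStep F X S (q i) (q k) (Y (q i))) -
          (A j - A k - eulerStep F X S (q k) (q j) (Y (q k))) =
          stepDefect F (X (q k) - X (q i)) (X (q j) - X (q k)) (S (q k) (q j)) (Y (q i))
            (Y (q k)) := by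
        rw [← eulerStep_add_sub hsymm hX (hmemT i hi) (hmemT k hk) (hmemT j hj)]
        abel
      simp only [e]
      exact norm_stepDefect_le_of_controlled hF hX hβ hc hY (hmemT i hi).1 (hq hik) (hq hkj.le)
        (hmemT j hj).2 (hmem i hi) (hmem k hk) (hYU _ (hmem i hi)) (hYU _ (hmem k hk)))
  simpa [hA] using main 0 (by simp) m (by simp) (Nat.zero_le m)

/-- The increment of `Y` is a limit of sums of Euler steps over $[s,t]$, and each such sum is within
$C|t-s|^{3\beta}$ of a single Euler step, uniformly in the partition. -/
theorem IsSolution.exists_isDavieOn (hβ : 1 / 3 < β) (hsymm : HasSymmetricDerivative F)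
    (hF : FieldBound F U K) (hX : PathBound β T κ X S) {τ : ℝ} (hτ : τ ≤ T) {ξ : W} {Y : ℝ → W}
    {Y' : ℝ → V →L[ℝ] W} (h : IsSolution β τ X S F ξ Y Y') {a b : ℝ} (ha : 0 ≤ a) (hb : b ≤ τ)
    (hYU : ∀ s ∈ Set.Icc a b, Y s ∈ U) :
    ∃ C ≥ 0, IsDavieOn β X S F C (Set.Icc a b) Y := by
  have hβ0 : 0 < β := by linarith
  have hκ := hX.one_le
  have hK := hF.one_le
  obtain ⟨c, hc, hY⟩ := h.exists_isControlledOn hβ0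
  have hl : 0 < 1 - 2 * (1 / 2 : ℝ) ^ (3 * β) := by
    linarith [two_mul_half_rpow_lt_one (a := 3 * β) (by linarith)]
  set C := 2 * (3 * K * κ * c ^ 2) / (1 - 2 * (1 / 2 : ℝ) ^ (3 * β)) with hC
  have hCl : C * (1 - 2 * (1 / 2 : ℝ) ^ (3 * β)) = 2 * (3 * K * κ * c ^ 2) :=
    div_mul_cancel₀ _ hl.ne'
  have hC0 : 0 ≤ C := by positivity
  refine ⟨C, hC0, fun s hs t ht hst => ?_⟩
  have hs0 : 0 ≤ s := ha.trans hs.1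
  have ht0 : t ≤ τ := ht.2.trans hb
  rcases hst.eq_or_lt with rfl | hlt
  · rw [residual_self hβ0 hX Y ⟨hs0, ht0.trans hτ⟩, norm_zero]
    exact mul_nonneg hC0 (Real.rpow_nonneg (by simp) _)
  obtain ⟨A, hA, hYA⟩ := h.equation s ⟨hs0, hst.trans ht0⟩
  obtain ⟨B, hB, hYB⟩ := h.equation t ⟨hs0.trans hst, ht0⟩
  refine le_of_forall_pos_le_add fun ε hε => ?_
  obtain ⟨m, q, hq0, hqm, hq, hlt⟩ := exists_riemann_sum_sub_lt
    (f := fun u v => F (Y u) (X v - X u) + tensorLift ((fderiv ℝ F (Y u)).comp (Y' u)) (S u v))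
    hs0 hlt hA hB hε
  have hsum : ∑ i ∈ Finset.range m, (F (Y (q i)) (X (q (i + 1)) - X (q i)) +
      tensorLift ((fderiv ℝ F (Y (q i))).comp (Y' (q i))) (S (q i) (q (i + 1)))) =
      ∑ i ∈ Finset.range m, eulerStep F X S (q i) (q (i + 1)) (Y (q i)) := by
    refine Finset.sum_congr rfl fun i hi => ?_
    have hi' := (Finset.mem_range.1 hi).le
    rw [h.deriv_eq (q i) ⟨hs0.trans (hq0 ▸ hq (Nat.zero_le i)), (hq hi').trans (hqm ▸ ht0)⟩]
    rfl
  rw [hsum] at hlt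
  have key := norm_riemann_sum_sub_le hsymm hF hX hβ0 hc ha (hb.trans hτ)
    (hY.mono (Set.Icc_subset_Icc ha hb)) hYU hC0 (by linarith) hq (hq0 ▸ hs.1) (hqm ▸ ht.2)
  rw [hq0, hqm] at key
  have e : residual F X S Y s t =
      (∑ i ∈ Finset.range m, eulerStep F X S (q i) (q (i + 1)) (Y (q i)) -
        eulerStep F X S s t (Y s)) -
      (∑ i ∈ Finset.range m, eulerStep F X S (q i) (q (i + 1)) (Y (q i)) - (B - A)) := by
    rw [residual, hYA, hYB]
    abel
  rw [e]
  exact (norm_sub_le _ _).trans (add_le_add key hlt.le)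

/-! ### Uniqueness of solutions -/

theorem IsSolution.apply_zero {τ : ℝ} (hτ : 0 ≤ τ) {ξ : W} {Y : ℝ → W} {Y' : ℝ → V →L[ℝ] W}
    (h : IsSolution β τ X S F ξ Y Y') : Y 0 = ξ := by
  obtain ⟨I, hI, hY⟩ := h.equation 0 ⟨le_rfl, hτ⟩
  have hI0 : ‖I‖ ≤ 0 := le_of_forall_pos_le_add fun ε hε => by
    obtain ⟨δ, -, hδ⟩ := hI ε hε
    -- The only partition of $[0,0]$ is the trivial one, whose sum is empty.
    have := hδ 0 (fun _ => 0) ⟨rfl, rfl, by simp⟩ (by simp)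
    simpa using this.le
  rw [hY, norm_le_zero_iff.1 hI0, add_zero]

/-- The coincidence set is closed, and from each of its points before `τ` equality extends to the
right. Only local bounds on `F` enter: both paths stay in a small ball about the common value for a
short time. -/
theorem IsSolution.eqOn (hβ : 1 / 3 < β) (hβ' : β ≤ 1 / 2) (hsymm : HasSymmetricDerivative F)
    (hF : ContDiff ℝ 3 F) (hX : PathBound β T κ X S) {τ : ℝ} (hτ0 : 0 ≤ τ) (hτ : τ ≤ T) {ξ : W}
    {Y Z : ℝ → W} {Y' Z' : ℝ → V →L[ℝ] W} (hY : IsSolution β τ X S F ξ Y Y')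
    (hZ : IsSolution β τ X S F ξ Z Z') : Set.EqOn Y Z (Set.Icc 0 τ) := by
  have hβ0 : 0 < β := by linarith
  obtain ⟨γ, hγ1, hγ, hγ'⟩ := exists_exponent hβ hβ'
  have hl' : 0 < 1 - 2 * (1 / 2 : ℝ) ^ γ := by linarith [two_mul_half_rpow_lt_one hγ1]
  obtain ⟨c₁, hc₁, hYc⟩ := hY.exists_isControlledOn hβ0
  obtain ⟨c₂, hc₂, hZc⟩ := hZ.exists_isControlledOn hβ0
  set c := max c₁ c₂ with hc
  have hc1 : 1 ≤ c := hc₁.le.trans (le_max_left _ _)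
  replace hYc := hYc.mono_const (le_max_left c₁ c₂)
  replace hZc := hZc.mono_const (le_max_right c₁ c₂)
  have hclosed : IsClosed ({t | Y t = Z t} ∩ Set.Icc 0 τ) := by
    have := ((hYc.continuousOn hβ0).sub (hZc.continuousOn hβ0)).preimage_isClosed_of_isClosed
      isClosed_Icc (isClosed_singleton (x := (0 : W)))
    convert this using 1
    ext t
    simp [sub_eq_zero, and_comm]
  refine hclosed.Icc_subset_of_forall_mem_nhdsWithin ?_ fun x hx => ?_
  · exact (hY.apply_zero hτ0).trans (hZ.apply_zero hτ0).symm
  obtain ⟨hYZ, hx0, hxτ⟩ := hx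
  obtain ⟨R, hR, K, hFB⟩ := exists_fieldBound_closedBall hF (Y x)
  obtain ⟨h, ⟨⟨h1, h2⟩, h3⟩, h4⟩ :=
    ((((eventually_mul_rpow_le c hR hβ0).and
      (eventually_mul_rpow_le (66 * K ^ 2 * κ ^ 2 * c ^ 2) (half_pos hl') (sub_pos.2 hγ))).and
      (eventually_mul_rpow_le 1 one_pos one_pos)).and self_mem_nhdsWithin).exists
  rw [Real.rpow_one, one_mul] at h3
  have h4' : 0 < h := h4
  set b := min (x + h) τ with hb
  have hxb : x < b := lt_min (by linarith) hxτ
  have hbh : b ≤ x + h := min_le_left _ _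
  have hbτ : b ≤ τ := min_le_right _ _
  have hsub : Set.Icc x b ⊆ Set.Icc 0 τ := Set.Icc_subset_Icc hx0 hbτ
  have hball : ∀ Q : ℝ → W, IsControlledOn β X F c (Set.Icc 0 τ) Q → Q x = Y x →
      ∀ s ∈ Set.Icc x b, Q s ∈ Metric.closedBall (Y x) R := by
    intro Q hQ hQx s hs
    rw [mem_closedBall_iff_norm, ← hQx]
    refine (hQ x ⟨hx0, hxτ.le⟩ s (hsub hs) hs.1).1.trans (le_trans ?_ h1)
    exact mul_le_mul_of_nonneg_left (Real.rpow_le_rpow (sub_nonneg.2 hs.1)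
      (by linarith [hs.2]) hβ0.le) (by linarith)
  obtain ⟨C₁, hC₁, hYD⟩ := hY.exists_isDavieOn hβ hsymm hFB hX hτ hx0 hbτ (hball Y hYc rfl)
  obtain ⟨C₂, hC₂, hZD⟩ := hZ.exists_isDavieOn hβ hsymm hFB hX hτ hx0 hbτ (hball Z hZc hYZ.symm)
  have hmono : ∀ {D D' : ℝ} {Q : ℝ → W}, D ≤ D' → IsDavieOn β X S F D (Set.Icc x b) Q →
      IsDavieOn β X S F D' (Set.Icc x b) Q := fun hD hQ s hs t ht hst =>
    (hQ s hs t ht hst).trans (mul_le_mul_of_nonneg_right hD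
      (Real.rpow_nonneg (sub_nonneg.2 hst) _))
  have := davie_unique hsymm hFB hX hβ0 hγ hγ' hγ1 hc1 hx0 (hbτ.trans hτ) hbh h4'.le h3
    (C := max C₁ C₂) (le_max_of_le_left hC₁) h2 hYZ (hball Y hYc rfl) (hball Z hZc hYZ.symm)
    (hYc.mono hsub) (hZc.mono hsub) (hmono (le_max_left _ _) hYD) (hmono (le_max_right _ _) hZD)
  exact Filter.mem_of_superset (Icc_mem_nhdsGT hxb) this

/-! ### Davie's expansion yields solutions -/

theorem IsDavieOn.exists_isControlledOn (hβ : 0 < β) (hF : FieldBound F U K)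
    (hX : PathBound β T κ X S) {C a b : ℝ} (hC : 0 ≤ C) (ha : 0 ≤ a) (hb : b ≤ T) {Y : ℝ → W}
    (hY : IsDavieOn β X S F C (Set.Icc a b) Y) (hYU : ∀ s ∈ Set.Icc a b, Y s ∈ U) :
    ∃ c ≥ 1, IsControlledOn β X F c (Set.Icc a b) Y := by
  have hκ := hX.one_le
  have hK := hF.one_le
  set L := (b - a) ^ β
  refine ⟨max 1 (max (K * κ + C * L) (K * κ + (K * κ + C * L) * L)), le_max_left _ _,
    fun s hs t ht hst => ?_⟩
  have hs0 : 0 ≤ s := ha.trans hs.1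
  have htT : t ≤ T := ht.2.trans hb
  have hw : (t - s) ^ β ≤ L :=
    Real.rpow_le_rpow (by linarith) (by linarith [hs.1, ht.2]) hβ.le
  have hw0 : 0 ≤ (t - s) ^ β := Real.rpow_nonneg (by linarith) _
  have hL0 : 0 ≤ L := hw0.trans hw
  have hr := hY s hs t ht hst
  rw [rpow_three_mul (by linarith)] at hr
  have h1 := (norm_remainder_le hF hX hs0 hst htT (hYU s hs) hr).trans
    (mul_le_mul_of_nonneg_right (add_le_add le_rfl (mul_le_mul_of_nonneg_left hw hC))
      (sq_nonneg _))
  have h2 := (norm_increment_le hF hX hs0 hst htT (hYU s hs) h1).trans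
    (mul_le_mul_of_nonneg_right (add_le_add le_rfl (mul_le_mul_of_nonneg_left hw (by positivity)))
      hw0)
  exact ⟨h2.trans (mul_le_mul_of_nonneg_right ((le_max_right _ _).trans (le_max_right _ _)) hw0),
    h1.trans (mul_le_mul_of_nonneg_right ((le_max_left _ _).trans (le_max_right _ _))
      (sq_nonneg _))⟩

theorem IsDavieOn.isSolution (hβ : 1 / 3 < β) (hF : FieldBound F U K)
    (hX : PathBound β T κ X S) {C τ : ℝ} (hC : 0 ≤ C) (hτ : τ ≤ T) {Y : ℝ → W}
    (hY : IsDavieOn β X S F C (Set.Icc 0 τ) Y) (hYU : ∀ s ∈ Set.Icc 0 τ, Y s ∈ U) :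
    IsSolution β τ X S F (Y 0) Y (fun t => F (Y t)) := by
  have hβ0 : 0 < β := by linarith
  have hK := hF.one_le
  obtain ⟨c, hc, hYc⟩ := hY.exists_isControlledOn hβ0 hF hX hC le_rfl hτ hYU
  have hmem : ∀ {s t : ℝ}, 0 ≤ s → s < t → t ≤ τ → s ∈ Set.Icc 0 τ ∧ t ∈ Set.Icc 0 τ :=
    fun hs hst ht => ⟨⟨hs, hst.le.trans ht⟩, ⟨hs.trans hst.le, ht⟩⟩
  refine ⟨⟨⟨c, fun s t hs hst ht => ?_⟩, ⟨K * c, fun s t hs hst ht => ?_⟩,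
    ⟨c, fun s t hs hst ht => ?_⟩⟩, fun _ _ => rfl, fun t ht => ⟨Y t - Y 0, ?_, by abel⟩⟩
  · obtain ⟨h1, h2⟩ := hmem hs hst ht
    exact (hYc s h1 t h2 hst.le).1
  · obtain ⟨h1, h2⟩ := hmem hs hst ht
    rw [mul_assoc]
    exact (hF.c11.lipschitz hF.convex (hYU s h1) (hYU t h2)).trans
      (mul_le_mul_of_nonneg_left (hYc s h1 t h2 hst.le).1 (by linarith))
  · obtain ⟨h1, h2⟩ := hmem hs hst ht
    rw [mul_comm 2 β, Real.rpow_mul (by linarith)]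
    exact_mod_cast (hYc s h1 t h2 hst.le).2
  · intro ε hε
    -- The error of a compensated sum is minus the sum of the residuals, at most
    -- $C\delta^{3\beta-1}t$ when the mesh is below `δ`; it vanishes in the limit because
    -- $3\beta>1$.
    obtain ⟨δ, hδ, hle⟩ := exists_mul_rpow_le (C * t) (half_pos hε)
      (θ := 3 * β - 1) (by linarith)
    refine ⟨δ, hδ, fun n p hp hmesh => ?_⟩
    have e : ∑ i ∈ Finset.range n, (F (Y (p i)) (X (p (i + 1)) - X (p i)) +
        tensorLift ((fderiv ℝ F (Y (p i))).comp (F (Y (p i)))) (S (p i) (p (i + 1)))) -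
        (Y t - Y 0) = -∑ i ∈ Finset.range n, residual F X S Y (p i) (p (i + 1)) := by
      have h1 := Finset.sum_range_sub (fun i => Y (p i)) n
      simp only [hp.1, hp.2.1] at h1
      rw [← h1, ← Finset.sum_sub_distrib, ← Finset.sum_neg_distrib]
      refine Finset.sum_congr rfl fun i _ => ?_
      rw [residual, eulerStep, fieldDeriv]
      abel
    rw [e, norm_neg]
    refine ((norm_sum_le_of_le (f := fun i => residual F X S Y (p i) (p (i + 1)))
      (n := fun i => C * δ ^ (3 * β - 1) * (p (i + 1) - p i)) _ fun i hi => ?_).trans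
      (?_ : _ ≤ ε / 2)).trans_lt (half_lt_self hε)
    · have hi' := Finset.mem_range.1 hi
      have hd : 0 < p (i + 1) - p i := sub_pos.2 (hp.2.2 i hi')
      have hsub : Set.Icc 0 t ⊆ Set.Icc 0 τ := Set.Icc_subset_Icc le_rfl ht.2
      refine (hY _ (hsub (hp.mem_Icc hi'.le)) _ (hsub (hp.mem_Icc hi')) (hp.2.2 i hi').le).trans ?_
      have e2 : (p (i + 1) - p i) ^ (3 * β) =
          (p (i + 1) - p i) ^ (3 * β - 1) * (p (i + 1) - p i) := by
        rw [← Real.rpow_add_one hd.ne']; congr 1; ring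
      rw [e2, ← mul_assoc]
      have := Real.rpow_le_rpow hd.le (hmesh i hi').le (z := 3 * β - 1) (by linarith)
      gcongr
    · rw [← Finset.mul_sum, Finset.sum_range_sub, hp.1, hp.2.1, sub_zero]
      linarith

/-! ### Restriction of solutions to shorter intervals -/

theorem HolderBound.mono {E : Type*} [NormedAddCommGroup E] {γ τ τ' : ℝ} {A : ℝ → ℝ → E}
    (h : HolderBound γ τ' A) (hτ : τ ≤ τ') : HolderBound γ τ A := by
  obtain ⟨C, hC⟩ := h
  exact ⟨C, fun s t hs hst ht => hC s t hs hst (ht.trans hτ)⟩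

theorem IsSolution.mono {τ τ' : ℝ} {ξ : W} {Y : ℝ → W} {Y' : ℝ → V →L[ℝ] W}
    (h : IsSolution β τ' X S F ξ Y Y') (hτ : τ ≤ τ') : IsSolution β τ X S F ξ Y Y' :=
  ⟨⟨h.controlled.holder.mono hτ, h.controlled.holder_deriv.mono hτ,
    h.controlled.holder_remainder.mono hτ⟩,
    fun t ht => h.deriv_eq t ⟨ht.1, ht.2.trans hτ⟩,
    fun t ht => h.equation t ⟨ht.1, ht.2.trans hτ⟩⟩

theorem IsSolution.eqOn_deriv {τ : ℝ} {ξ : W} {Y Z : ℝ → W} {Y' Z' : ℝ → V →L[ℝ] W}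
    (hY : IsSolution β τ X S F ξ Y Y') (hZ : IsSolution β τ X S F ξ Z Z')
    (h : Set.EqOn Z Y (Set.Icc 0 τ)) : Set.EqOn Z' Y' (Set.Icc 0 τ) := fun t ht => by
  rw [hY.deriv_eq t ht, hZ.deriv_eq t ht, h ht]

/-! ### Gluing and global existence -/

/-- For $s\le u\le t$ the residual is the sum of the residuals on both sides and one defect. That
defect involves only the values at `s` and `u`, so control of `Y₁` suffices. -/
theorem IsDavieOn.exists_glue (hsymm : HasSymmetricDerivative F) (hF : FieldBound F Set.univ K)
    (hX : PathBound β T κ X S) (hβ : 0 < β) {C₁ C₂ a u b : ℝ} (hC₁ : 0 ≤ C₁) (hC₂ : 0 ≤ C₂)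
    (ha : 0 ≤ a) (hau : a ≤ u) (hub : u ≤ b) (hb : b ≤ T) {Y₁ Y₂ : ℝ → W} (hY : Y₂ u = Y₁ u)
    (h₁ : IsDavieOn β X S F C₁ (Set.Icc a u) Y₁) (h₂ : IsDavieOn β X S F C₂ (Set.Icc u b) Y₂) :
    ∃ Y : ℝ → W, Y a = Y₁ a ∧ ∃ C ≥ 0, IsDavieOn β X S F C (Set.Icc a b) Y := by
  have hκ := hX.one_le
  have hK := hF.one_le
  obtain ⟨c, hc, hctrl⟩ := h₁.exists_isControlledOn hβ hF hX hC₁ ha (hub.trans hb)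
    fun _ _ => Set.mem_univ _
  set Y : ℝ → W := fun t => if t ≤ u then Y₁ t else Y₂ t with hYdef
  have hYl : ∀ t ≤ u, Y t = Y₁ t := fun t ht => if_pos ht
  have hYr : ∀ t, u ≤ t → Y t = Y₂ t := fun t ht => by
    rcases ht.eq_or_lt with rfl | ht
    · rw [hYl _ le_rfl, hY]
    · exact if_neg ht.not_ge
  have hres : ∀ (Q : ℝ → W) s t, Y s = Q s → Y t = Q t →
      residual F X S Y s t = residual F X S Q s t := fun Q s t hs ht => by
    rw [residual, residual, hs, ht]
  have hD : 0 ≤ 3 * K * κ * c ^ 2 := by positivity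
  refine ⟨Y, hYl a hau, C₁ + C₂ + 3 * K * κ * c ^ 2, by positivity, fun s hs t ht hst => ?_⟩
  have hw0 : 0 ≤ (t - s) ^ (3 * β) := Real.rpow_nonneg (by linarith) _
  rcases le_total t u with htu | htu
  · rw [hres Y₁ s t (hYl s (hst.trans htu)) (hYl t htu)]
    exact (h₁ s ⟨hs.1, hst.trans htu⟩ t ⟨ht.1, htu⟩ hst).trans
      (mul_le_mul_of_nonneg_right (by linarith) hw0)
  rcases le_total u s with hus | hsu
  · rw [hres Y₂ s t (hYr s hus) (hYr t (hus.trans hst))]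
    exact (h₂ s ⟨hus, hs.2⟩ t ⟨hus.trans hst, ht.2⟩ hst).trans
      (mul_le_mul_of_nonneg_right (by linarith) hw0)
  have hs0 : 0 ≤ s := ha.trans hs.1
  have htT : t ≤ T := ht.2.trans hb
  have b1 : ‖residual F X S Y s u‖ ≤ C₁ * (t - s) ^ (3 * β) := by
    rw [hres Y₁ s u (hYl s hsu) (hYl u le_rfl)]
    exact (h₁ s ⟨hs.1, hsu⟩ u ⟨hau, le_rfl⟩ hsu).trans (mul_le_mul_of_nonneg_left
      (Real.rpow_le_rpow (by linarith) (by linarith) (by linarith)) hC₁)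
  have b2 : ‖residual F X S Y u t‖ ≤ C₂ * (t - s) ^ (3 * β) := by
    rw [hres Y₂ u t (hYr u le_rfl) (hYr t htu)]
    exact (h₂ u ⟨le_rfl, hub⟩ t ⟨htu, ht.2⟩ htu).trans (mul_le_mul_of_nonneg_left
      (Real.rpow_le_rpow (by linarith) (by linarith) (by linarith)) hC₂)
  have b3 : ‖residual F X S Y s t - residual F X S Y s u - residual F X S Y u t‖ ≤
      3 * K * κ * c ^ 2 * (t - s) ^ (3 * β) := by
    rw [residual_sub_sub hsymm hX Y ⟨hs0, by linarith⟩ ⟨by linarith, by linarith⟩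
      ⟨by linarith, htT⟩, hYl s hsu, hYl u le_rfl]
    exact norm_stepDefect_le_of_controlled hF hX hβ hc hctrl hs0 hsu htu htT ⟨hs.1, hsu⟩
      ⟨hau, le_rfl⟩ (Set.mem_univ _) (Set.mem_univ _)
  have e : residual F X S Y s t =
      residual F X S Y s u + residual F X S Y u t +
      (residual F X S Y s t - residual F X S Y s u - residual F X S Y u t) := by abel
  rw [e, add_mul, add_mul]
  exact (norm_add_le _ _).trans (add_le_add ((norm_add_le _ _).trans (add_le_add b1 b2)) b3)

theorem exists_davie_global (hβ : 1 / 3 < β) (hβ' : β ≤ 1 / 2) (hsymm : HasSymmetricDerivative F)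
    (hF : FieldBound F Set.univ K) (hX : PathBound β T κ X S) (hT : 0 < T) (ξ : W) :
    ∃ Y : ℝ → W, Y 0 = ξ ∧ ∃ C ≥ 0, IsDavieOn β X S F C (Set.Icc 0 T) Y := by
  have hβ0 : 0 < β := by linarith
  -- The radius is arbitrary because `U` will be the whole space. Since `h` is fixed before the
  -- starting point, equal steps of length $T/n\le h$ reach `T`; the Davie constant may grow with
  -- each gluing.
  obtain ⟨h, hh, C, hC, hloc⟩ := exists_davie_local (F := F) hβ hβ' hsymm hX hF.one_le one_pos
  obtain ⟨n, hn⟩ := exists_nat_gt (T / h)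
  have hn0 : (0 : ℝ) < n := (div_pos hT hh).trans hn
  have hstep : T / n ≤ h := by
    rw [div_lt_iff₀ hh] at hn
    rw [div_le_iff₀ hn0]
    linarith
  have hpos : 0 ≤ T / n := by positivity
  have key : ∀ k : ℕ, k ≤ n → ∃ Y : ℝ → W, Y 0 = ξ ∧
      ∃ C ≥ 0, IsDavieOn β X S F C (Set.Icc 0 (k * (T / n))) Y := by
    intro k
    induction k with
    | zero =>
      refine fun _ => ⟨fun _ => ξ, rfl, 0, le_rfl, fun s hs t ht _ => ?_⟩
      simp only [Nat.cast_zero, zero_mul, Set.Icc_self, Set.mem_singleton_iff] at hs ht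
      rw [hs, ht, residual_self hβ0 hX _ ⟨le_rfl, hT.le⟩]
      simp
    | succ k ih =>
      intro hk
      obtain ⟨Y₁, hY₁, C₁, hC₁, hD₁⟩ := ih (by omega)
      have hkn : ((k + 1 : ℕ) : ℝ) * (T / n) ≤ T := by
        have : ((k + 1 : ℕ) : ℝ) ≤ n := by exact_mod_cast hk
        calc ((k + 1 : ℕ) : ℝ) * (T / n) ≤ n * (T / n) := by gcongr
          _ = T := by field_simp
      have hle : (k : ℝ) * (T / n) ≤ ((k + 1 : ℕ) : ℝ) * (T / n) := by
        push_cast; linarith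
      obtain ⟨Y₂, hY₂, -, hD₂⟩ := hloc Set.univ (Y₁ (k * (T / n))) (k * (T / n))
        ((k + 1 : ℕ) * (T / n)) hF (by positivity) hle hkn (by push_cast; linarith)
        (Set.subset_univ _)
      obtain ⟨Y, hY, hD⟩ := hD₁.exists_glue hsymm hF hX hβ0 hC₁ hC le_rfl (by positivity) hle hkn
        hY₂ hD₂
      exact ⟨Y, hY.trans hY₁, hD⟩
  have := key n le_rfl
  rwa [show (n : ℝ) * (T / n) = T by field_simp] at this

end Solution

end

end ReducedRough

/-! ### Assembly of the local and global statements -/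

theorem theorem3p6 {V W : Type*}
    [NormedAddCommGroup V] [NormedSpace ℝ V] [CompleteSpace V]
    [NormedAddCommGroup W] [NormedSpace ℝ W] [CompleteSpace W]
    (β : ℝ) (hβ : 1 / 3 < β) (hβ' : β ≤ 1 / 2) (T : ℝ) (hT : 0 < T)
    (X : ℝ → V) (S : ℝ → ℝ → ReducedRough.Tensor2 V)
    (hX : ReducedRough.IsReducedRoughPath β T X S)
    (ξ : W) (F : W → V →L[ℝ] W) (hF : ContDiff ℝ 3 F)
    (hsymm : ReducedRough.HasSymmetricDerivative F) :
    -- local existence and uniqueness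
    (∃ τ₀ : ℝ, 0 < τ₀ ∧ τ₀ ≤ T ∧ ∀ τ : ℝ, 0 < τ → τ ≤ τ₀ →
      ∃ (Y : ℝ → W) (Y' : ℝ → V →L[ℝ] W),
        ReducedRough.IsSolution β τ X S F ξ Y Y' ∧
        ∀ (Z : ℝ → W) (Z' : ℝ → V →L[ℝ] W), ReducedRough.IsSolution β τ X S F ξ Z Z' →
          Set.EqOn Z Y (Set.Icc 0 τ) ∧ Set.EqOn Z' Y' (Set.Icc 0 τ)) ∧
    -- global existence and uniqueness; the global solution extends every local one
    (ReducedRough.IsCb 3 F →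
      ∃ (Y : ℝ → W) (Y' : ℝ → V →L[ℝ] W),
        ReducedRough.IsSolution β T X S F ξ Y Y' ∧
        ∀ τ : ℝ, 0 < τ → τ ≤ T →
          ∀ (Z : ℝ → W) (Z' : ℝ → V →L[ℝ] W), ReducedRough.IsSolution β τ X S F ξ Z Z' →
            Set.EqOn Z Y (Set.Icc 0 τ) ∧ Set.EqOn Z' Y' (Set.Icc 0 τ)) := by
  obtain ⟨κ, hκ⟩ := hX.exists_pathBound (by linarith)
  have huniq : ∀ {τ τ' : ℝ} {Y : ℝ → W} {Y' : ℝ → V →L[ℝ] W},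
      ReducedRough.IsSolution β τ' X S F ξ Y Y' → 0 < τ → τ ≤ τ' → τ' ≤ T →
      ∀ (Z : ℝ → W) (Z' : ℝ → V →L[ℝ] W), ReducedRough.IsSolution β τ X S F ξ Z Z' →
        Set.EqOn Z Y (Set.Icc 0 τ) ∧ Set.EqOn Z' Y' (Set.Icc 0 τ) := by
    intro τ τ' Y Y' hY hτ hττ hτT Z Z' hZ
    have hY' := hY.mono hττ
    have h := hZ.eqOn hβ hβ' hsymm hF hκ hτ.le (hττ.trans hτT) hY'
    exact ⟨h, hY'.eqOn_deriv hZ h⟩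
  refine ⟨?_, fun hCb => ?_⟩
  · obtain ⟨R, hR, K, hK⟩ := ReducedRough.exists_fieldBound_closedBall hF ξ
    obtain ⟨h, hh, C, hC, hloc⟩ :=
      ReducedRough.exists_davie_local (F := F) hβ hβ' hsymm hκ hK.one_le hR
    obtain ⟨Y, hY0, hYball, hYD⟩ := hloc _ ξ 0 (min h T) hK le_rfl (le_min hh.le hT.le)
      (min_le_right _ _) (by rw [zero_add]; exact min_le_left _ _) subset_rfl
    have hsol := hYD.isSolution hβ hK hκ hC (min_le_right _ _) hYball
    rw [hY0] at hsol
    -- One solution on $[0,\min(h,T)]$ serves every shorter interval by restriction.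
    exact ⟨min h T, lt_min hh hT, min_le_right _ _, fun τ hτ hle =>
      ⟨Y, _, hsol.mono hle, huniq hsol hτ hle (min_le_right _ _)⟩⟩
  · obtain ⟨-, C, hC⟩ := hCb
    obtain ⟨K, hK⟩ := ReducedRough.exists_fieldBound hF convex_univ (fun k hk x _ => hC k hk x)
    obtain ⟨Y, hY0, C', hC', hYD⟩ := ReducedRough.exists_davie_global hβ hβ' hsymm hK hκ hT ξ
    have hsol := hYD.isSolution hβ hK hκ hC' le_rfl fun _ _ => Set.mem_univ _
    rw [hY0] at hsol
    exact ⟨Y, _, hsol, fun τ hτ hle => huniq hsol hτ hle le_rfl⟩
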